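/- **Notation.** Let $p>2$ be a prime (in particular, any $p>3$). Let $\mathcal B_4=\mathcal B_4(\mathbb Z_p)$ be the Engel group, i.e. the compact group $\mathbb Z_p^4$ with $$\mathbf x\star\mathbf y=\big(x_1+y_1,\;x_2+y_2,\;x_3+y_3+x_1y_2,\;x_4+y_4+x_1y_3+\tfrac12x_1^2y_2\big).$$ Let $|\cdot|_p$ and $\vartheta$ be the $p$-adic norm and valuation, $\{u\}_p\in\mathbb Q$ the fractional part of $u\in\mathbb Q_p$, and $du$ the normalized Haar measure on $\mathbb Z_p$. Each class in $\widehat{\mathbb Z}_p=\mathbb Q_p/\mathbb Z_p$ is identified with its representative in $\{1\}\cup\{\sum_{k\ge1}\lambda_kp^{-k}\}$ (digits $0\le\lambda_k<p$, finitely many and at least one non-zero), the trivial class being represented by $1$, so that it has norm $1$. For $n\ge0$, "$\lambda\in\mathbb Q_p/p^{-n}\mathbb Z_p$" means that this representative lies in $\{1\}\cup\{\sum_{k\ge n+1}\lambda_kp^{-k}\}$. Let $\widehat{\mathbb H}_1$ be the set of $(\xi_1,\xi_2,\xi_3)\in\widehat{\mathbb Z}_p^3$ with $\xi_1,\xi_2\in\mathbb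 Q_p/p^{\vartheta(\xi_3)}\mathbb Z_p$. Put $\|(\xi_3,\xi_4)\|_p=\max\{|\xi_3|_p,|\xi_4|_p\}$, $\vartheta(\xi_3,\xi_4)=\min\{\vartheta(\xi_3),\vartheta(\xi_4)\}$, and $\xi\cdot\mathbf x=\sum_{i=1}^4\xi_ix_i$. **Theorem.** The unitary dual of $\mathcal B_4$, i.e. the set of unitary equivalence classes of (strongly continuous) irreducible unitary representations of $\mathcal B_4$ on Hilbert spaces, is identified with $$\widehat{\mathcal B}_4=\big\{\xi\in\widehat{\mathbb Z}_p^4:\ \big(1\le|\xi_4|_p<|\xi_3|_p\ \wedge\ (\xi_1,\xi_2,\xi_3)\in\widehat{\mathbb H}_1\big)\ \text{or}\ \big(|\xi_3|_p=1\ \wedge\ \xi_1\in\mathbb Q_p/p^{\vartheta(\xi_4)}\mathbb Z_p\big)\big\}$$ through $\xi\mapsto[\pi_\xi]$, as follows. For $\xi\in\widehat{\mathcal B}_4$ let $$\mathcal H_\xi=\mathrm{span}_{\mathbb C}\{\varphi_h: h\in\mathbb Z_p/p^{-\vartheta(\xi_3,\xi_4)}\mathbb Z_p\}\subset L^2(\mathbb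 Z_p),\qquad \varphi_h=\|(\xi_3,\xi_4)\|_p^{1/2}\,\mathbf 1_{h+p^{-\vartheta(\xi_3,\xi_4)}\mathbb Z_p}.$$ 1. The $\varphi_h$ form an orthonormal basis of $\mathcal H_\xi$, and $\dim_{\mathbb C}\mathcal H_\xi=\max\{|\xi_3|_p,|\xi_4|_p\}$. 2. The formula $$\pi_\xi(\mathbf x)\varphi(u)=e^{2\pi i\{\xi_1x_1+\xi_2x_2+\xi_3(x_3+ux_2)+\xi_4(x_4+ux_3+\frac{u^2}2x_2)\}_p}\,\varphi(u+x_1)$$ defines an irreducible unitary representation of $\mathcal B_4$ on $\mathcal H_\xi$. 3. The map $\xi\mapsto[\pi_\xi]$ is a bijection of $\widehat{\mathcal B}_4$ onto the unitary dual: every irreducible unitary representation of $\mathcal B_4$ is unitarily equivalent to $\pi_\xi$ for exactly one $\xi\in\widehat{\mathcal B}_4$. 4. For $h,h'\in\mathbb Z_p$ the matrix coefficients are $$(\pi_\xi(\mathbf x))_{hh'}:=(\pi_\xi(\mathbf x)\varphi_h,\varphi_{h'})_{L^2(\mathbb Z_p)}=e^{2\pi i\{\xi\cdot\mathbf x+(\xi_3x_2+\xi_4x_3)h'+\xi_4x_2\frac{(h')^2}2\}_p}\,\mathbf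 1_{h-h'+p^{-\vartheta(\xi_3,\xi_4)}\mathbb Z_p}(x_1).$$ 5. The characters are $$\chi_{\pi_\xi}(\mathbf x)=\|(\xi_3,\xi_4)\|_p\,e^{2\pi i\{\xi\cdot\mathbf x\}_p}\,\mathbf 1_{p^{-\vartheta(\xi_3,\xi_4)}\mathbb Z_p}(x_1)\int_{\mathbb Z_p}e^{2\pi i\{(\xi_3x_2+\xi_4x_3)u+\xi_4x_2\frac{u^2}2\}_p}\,du.$$ -/

import Mathlib

open MeasureTheory

noncomputable section

/-! ### The dual group of `ℤ_p` -/

section PadicDual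

variable {p : ℕ} [Fact p.Prime]

/-- The integer `max 0 (-ϑ(u))`, where `ϑ` is the `p`-adic valuation (it is `0` for `u = 0`). -/
def poleOrder (u : ℚ_[p]) : ℕ := (-u.valuation).toNat

theorem norm_mul_pow_poleOrder_le (u : ℚ_[p]) : ‖u * (p : ℚ_[p]) ^ poleOrder u‖ ≤ 1 := by
  by_cases hu : u = 0
  · simp [hu]
  have hp : (1 : ℝ) < p := by exact_mod_cast (Fact.out : p.Prime).one_lt
  rw [norm_mul, norm_pow, Padic.norm_p, Padic.norm_eq_zpow_neg_valuation hu, inv_pow,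
    ← zpow_natCast, ← zpow_neg, ← zpow_add₀ (by positivity)]
  apply zpow_le_one_of_nonpos₀ hp.le
  have := Int.self_le_toNat (-u.valuation)
  unfold poleOrder
  omega

/-- The `p`-adic integer `p ^ poleOrder u * u`. -/
def clearPole (u : ℚ_[p]) : ℤ_[p] := ⟨u * (p : ℚ_[p]) ^ poleOrder u, norm_mul_pow_poleOrder_le u⟩

theorem coe_clearPole (u : ℚ_[p]) : (clearPole u : ℚ_[p]) = u * (p : ℚ_[p]) ^ poleOrder u := rfl

/-- The fractional part `{u}_p`. If `ϑ(u) = -n < 0` and `p ^ n * u = ∑ u_j p ^ j`, it is the rational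
number `p ^ (-n) * ∑_{j < n} u_j p ^ j`; the sum is the representative in `[0, p ^ n)` of the residue
of `p ^ n * u` modulo `p ^ n`. It is `0` if `u = 0` or `ϑ(u) ≥ 0` (then `n = 0`). -/
def padicFract (u : ℚ_[p]) : ℚ :=
  ((PadicInt.toZModPow (poleOrder u) (clearPole u)).val : ℚ) / (p : ℚ) ^ poleOrder u

/-- The character `u ↦ e^{2 π i {u}_p}`. -/
def padicExp (u : ℚ_[p]) : ℂ :=
  Complex.exp (2 * (Real.pi : ℂ) * Complex.I * ((padicFract u : ℚ) : ℂ))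

theorem poleOrder_eq_zero {u : ℚ_[p]} (hu : ‖u‖ ≤ 1) : poleOrder u = 0 := by
  have := (Padic.norm_le_one_iff_val_nonneg u).1 hu
  unfold poleOrder
  omega

theorem padicFract_eq_zero {u : ℚ_[p]} (hu : ‖u‖ ≤ 1) : padicFract u = 0 := by
  have key : ∀ n : ℕ, n = 0 → ∀ z : ZMod (p ^ n), z.val = 0 := by
    rintro n rfl z
    have hz := ZMod.val_lt (n := p ^ 0) z
    have h1 : p ^ 0 = 1 := pow_zero p
    omega
  simp [padicFract, key _ (poleOrder_eq_zero hu)]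

theorem padicFract_congr {u v : ℚ_[p]} (huv : ‖u - v‖ ≤ 1) : padicFract u = padicFract v := by
  by_cases hu : ‖u‖ ≤ 1
  · have hv : ‖v‖ ≤ 1 := by
      have h := Padic.nonarchimedean u (-(u - v))
      rw [norm_neg] at h
      have h2 : u + -(u - v) = v := by ring
      rw [h2] at h
      exact h.trans (max_le hu huv)
    rw [padicFract_eq_zero hu, padicFract_eq_zero hv]
  · push Not at hu
    have hn : ‖u‖ = ‖v‖ := by
      have h3 : ‖u + -(u - v)‖ = max ‖u‖ ‖-(u - v)‖ := by
        apply Padic.add_eq_max_of_ne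
        rw [norm_neg]
        exact (huv.trans_lt hu).ne'
      rw [norm_neg, max_eq_left (huv.trans hu.le)] at h3
      rw [← h3]
      congr 1
      abel
    have hu0 : u ≠ 0 := by
      rintro rfl
      simp at hu
      linarith
    have hv0 : v ≠ 0 := by
      rintro rfl
      rw [norm_zero] at hn
      linarith
    have hval : u.valuation = v.valuation := by
      have hp : (1 : ℝ) < p := by exact_mod_cast (Fact.out : p.Prime).one_lt
      rw [Padic.norm_eq_zpow_neg_valuation hu0, Padic.norm_eq_zpow_neg_valuation hv0] at hn
      have := zpow_right_injective₀ (by positivity) hp.ne' hn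
      omega
    have hord : poleOrder u = poleOrder v := by simp only [poleOrder, hval]
    have key : ∀ n : ℕ, n = poleOrder u → PadicInt.toZModPow n (clearPole u)
        = PadicInt.toZModPow n (clearPole v) := by
      intro n hn
      rw [← sub_eq_zero, ← map_sub, ← RingHom.mem_ker, PadicInt.ker_toZModPow,
        Ideal.mem_span_singleton]
      obtain ⟨w, h1⟩ : ∃ w : ℤ_[p], (w : ℚ_[p]) = u - v := ⟨⟨u - v, huv⟩, rfl⟩
      refine ⟨w, ?_⟩
      apply PadicInt.ext
      rw [PadicInt.coe_sub, PadicInt.coe_mul, PadicInt.coe_pow, PadicInt.coe_natCast, h1,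
        coe_clearPole, coe_clearPole, ← hord, hn]
      ring
    rw [padicFract, padicFract, ← hord, key _ rfl]

variable (p) in
/-- The subgroup `ℤ_p` of `ℚ_p`. -/
abbrev padicIntSubgroup : AddSubgroup ℚ_[p] := (PadicInt.subring p).toAddSubgroup

variable (p) in
/-- The Prüfer group `ℚ_p / ℤ_p`, which is the dual group of `ℤ_p`. -/
abbrev ZpDual : Type := ℚ_[p] ⧸ padicIntSubgroup p

/-- The fractional part of a class in `ℚ_p / ℤ_p`. -/
def ZpDual.fract (l : ZpDual p) : ℚ :=
  Quotient.liftOn' l padicFract (by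
    intro a b hab
    rw [QuotientAddGroup.leftRel_apply] at hab
    apply padicFract_congr
    have : ‖-a + b‖ ≤ 1 := hab
    rw [← norm_neg]
    have h2 : -(a - b) = -a + b := by ring
    rw [h2]
    exact this)

open Classical in
/-- The representative in `ℚ_p` of a class in `ℚ_p / ℤ_p`, taken in the complete system
`{1} ∪ {∑_{k ≥ 1} λ_k p ^ (-k)}`: it is `1` for the trivial class, so that the trivial class has
`p`-adic norm `1`, and the fractional part for every other class. -/
def ZpDual.rep (l : ZpDual p) : ℚ_[p] := if l = 0 then 1 else ((l.fract : ℚ) : ℚ_[p])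

variable (p) in
/-- The complete system `{1} ∪ {∑_{k ≥ n + 1} λ_k p ^ (-k) : finitely many λ_k ≠ 0}` of
representatives of `ℚ_p / p ^ (-n) ℤ_p`, with digits `λ_k ∈ {0, …, p - 1}` that are not all zero. -/
def quotReps (n : ℕ) : Set ℚ_[p] :=
  {1} ∪ {a | ∃ c : ℕ →₀ ℕ, c ≠ 0 ∧ (∀ k, c k < p) ∧ (∀ k ≤ n, c k = 0) ∧
    a = c.sum fun k d => (d : ℚ_[p]) * (p : ℚ_[p]) ^ (-(k : ℤ))}

end PadicDual

/-! ### Haar measure on `ℤ_p` and `L²(ℤ_p)` -/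

section HaarMeasure

variable (p : ℕ) [Fact p.Prime]

instance instMeasurableSpacePadicInt : MeasurableSpace ℤ_[p] := borel _

instance instBorelSpacePadicInt : BorelSpace ℤ_[p] := ⟨rfl⟩

/-- The Haar measure on `ℤ_p` of total mass `1`. -/
def haarZp : Measure ℤ_[p] := Measure.addHaarMeasure ⊤

instance instIsProbabilityMeasureHaarZp : IsProbabilityMeasure (haarZp p) :=
  ⟨by simpa [haarZp] using
    Measure.addHaarMeasure_self (K₀ := (⊤ : TopologicalSpace.PositiveCompacts ℤ_[p]))⟩

/-- The Hilbert space `L²(ℤ_p)`. -/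
abbrev L2Zp : Type := Lp ℂ 2 (haarZp p)

/-- `ℤ_p / p ^ n ℤ_p`. -/
abbrev ZpMod (n : ℕ) : Type := ℤ_[p] ⧸ Ideal.span {(p : ℤ_[p]) ^ n}

instance instFiniteZpMod (n : ℕ) : Finite (ZpMod p n) := by
  have : NeZero (p ^ n) := ⟨pow_ne_zero _ (Fact.out : p.Prime).ne_zero⟩
  have h := PadicInt.ker_toZModPow (p := p) n
  unfold ZpMod
  rw [← h]
  exact Finite.of_injective _ (RingHom.kerLift_injective (PadicInt.toZModPow (p := p) n))

variable {p}

/-- The coset `h + p ^ n ℤ_p`, as a subset of `ℤ_p`. -/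
def cosetZp {n : ℕ} (h : ZpMod p n) : Set ℤ_[p] := {u | Ideal.Quotient.mk _ u = h}

theorem measurableSet_cosetZp {n : ℕ} (h : ZpMod p n) : MeasurableSet (cosetZp h) := by
  obtain ⟨a, rfl⟩ := Ideal.Quotient.mk_surjective h
  have : cosetZp (Ideal.Quotient.mk (Ideal.span {(p : ℤ_[p]) ^ n}) a)
      = Metric.closedBall a ((p : ℝ) ^ (-(n : ℤ))) := by
    ext u
    simp only [cosetZp, Set.mem_ofPred_eq, Ideal.Quotient.eq, Metric.mem_closedBall,
      dist_eq_norm, PadicInt.norm_le_pow_iff_mem_span_pow]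
  rw [this]
  exact Metric.isClosed_closedBall.measurableSet

end HaarMeasure

/-! ### Unitary representations and the unitary dual -/

section UnitaryDual

universe u v w

/-- A (strongly continuous) unitary representation of `G` on `H`. -/
structure UnitaryRep (G : Type u) [Group G] [TopologicalSpace G]
    (H : Type v) [NormedAddCommGroup H] [InnerProductSpace ℂ H] where
  /-- The underlying homomorphism into the unitary group of `H`. -/
  toHom : G →* (H ≃ₗᵢ[ℂ] H)
  continuous_apply : ∀ a : H, Continuous fun g => toHom g a

namespace UnitaryRep

variable {G : Type u} [Group G] [TopologicalSpace G]
  {H : Type v} [NormedAddCommGroup H] [InnerProductSpace ℂ H]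
  {K : Type w} [NormedAddCommGroup K] [InnerProductSpace ℂ K]

instance instCoeFun : CoeFun (UnitaryRep G H) fun _ => G → (H ≃ₗᵢ[ℂ] H) := ⟨fun π => π.toHom⟩

/-- Irreducibility: the space is non-zero and has no proper non-zero closed invariant subspace. -/
def IsIrreducible (π : UnitaryRep G H) : Prop :=
  Nontrivial H ∧ ∀ W : Submodule ℂ H, IsClosed (W : Set H) →
    (∀ g, ∀ a ∈ W, π g a ∈ W) → W = ⊥ ∨ W = ⊤

/-- Unitary equivalence: there is a unitary intertwining operator. -/
def Equivalent (π : UnitaryRep G H) (ρ : UnitaryRep G K) : Prop :=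
  ∃ T : H ≃ₗᵢ[ℂ] K, ∀ g a, T (π g a) = ρ g (T a)

/-- The character of a representation on a finite-dimensional space. -/
def character (π : UnitaryRep G H) (g : G) : ℂ :=
  LinearMap.trace ℂ H (π g).toLinearEquiv.toLinearMap

end UnitaryRep

/-- An irreducible unitary representation together with its Hilbert space. -/
structure UnitaryIrrep (G : Type u) [Group G] [TopologicalSpace G] where
  /-- The Hilbert space. -/
  Space : Type v
  [normedAddCommGroup : NormedAddCommGroup Space]
  [innerProductSpace : InnerProductSpace ℂ Space]
  [completeSpace : CompleteSpace Space]
  /-- The representation. -/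
  rep : UnitaryRep G Space
  irreducible : rep.IsIrreducible

attribute [instance] UnitaryIrrep.normedAddCommGroup UnitaryIrrep.innerProductSpace
  UnitaryIrrep.completeSpace

instance UnitaryIrrep.instSetoid (G : Type u) [Group G] [TopologicalSpace G] :
    Setoid (UnitaryIrrep.{u, v} G) where
  r π ρ := π.rep.Equivalent ρ.rep
  iseqv :=
    { refl := fun π => ⟨LinearIsometryEquiv.refl ℂ π.Space, fun _ _ => rfl⟩
      symm := by
        rintro π ρ ⟨T, hT⟩
        exact ⟨T.symm, fun g a => by
          rw [LinearIsometryEquiv.symm_apply_eq, hT, LinearIsometryEquiv.apply_symm_apply]⟩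
      trans := by
        rintro π ρ σ ⟨T, hT⟩ ⟨S, hS⟩
        exact ⟨T.trans S, fun g a => by
          simp only [LinearIsometryEquiv.trans_apply, hT, hS]⟩ }

/-- The unitary dual of `G`: equivalence classes of irreducible unitary representations. -/
def UnitaryDual (G : Type u) [Group G] [TopologicalSpace G] : Type (max u (v + 1)) :=
  Quotient (UnitaryIrrep.instSetoid.{u, v} G)

/-- The class in the unitary dual of an irreducible unitary representation. -/
def UnitaryDual.mk {G : Type u} [Group G] [TopologicalSpace G]
    {H : Type v} [NormedAddCommGroup H] [InnerProductSpace ℂ H] [CompleteSpace H]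
    (π : UnitaryRep G H) (hπ : π.IsIrreducible) : UnitaryDual.{u, v} G :=
  Quotient.mk _ { Space := H, rep := π, irreducible := hπ }

end UnitaryDual

/-! ### The Engel group over `ℤ_p` -/

section Engel

/-- The set `ℤ_p ^ 4` underlying the Engel group; the coordinates `x_1, x_2, x_3, x_4` are
`x 0, x 1, x 2, x 3`. -/
def EngelGroup (p : ℕ) [Fact p.Prime] : Type := Fin 4 → ℤ_[p]

variable (p : ℕ) [Fact p.Prime]

instance EngelGroup.instTopologicalSpace : TopologicalSpace (EngelGroup p) :=
  inferInstanceAs (TopologicalSpace (Fin 4 → ℤ_[p]))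

variable [Fact (2 < p)]

/-- The element `1 / 2` of `ℤ_p`, for odd `p`. -/
def halfZp : ℤ_[p] :=
  ⟨1 / 2, by
    have h2 : ‖((2 : ℕ) : ℚ_[p])‖ = 1 := by
      rw [Padic.norm_natCast_eq_one_iff]
      refine (Nat.coprime_primes (Fact.out : p.Prime) Nat.prime_two).2 ?_
      have : 2 < p := Fact.out
      omega
    rw [norm_div, norm_one]
    push_cast at h2
    rw [h2]
    norm_num⟩

theorem halfZp_mul_two : halfZp p * 2 = 1 := by
  apply PadicInt.ext
  have h : ((halfZp p : ℤ_[p]) : ℚ_[p]) = 1 / 2 := rfl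
  have h2 : ((2 : ℤ_[p]) : ℚ_[p]) = 2 := rfl
  rw [PadicInt.coe_mul, PadicInt.coe_one, h, h2]
  norm_num

/-- The group law
`x ⋆ y = (x₁ + y₁, x₂ + y₂, x₃ + y₃ + x₁ y₂, x₄ + y₄ + x₁ y₃ + (1/2) x₁² y₂)`. -/
instance EngelGroup.instGroup : Group (EngelGroup p) :=
  letI : Mul (EngelGroup p) := ⟨fun x y =>
    ![x 0 + y 0, x 1 + y 1, x 2 + y 2 + x 0 * y 1,
      x 3 + y 3 + x 0 * y 2 + halfZp p * x 0 ^ 2 * y 1]⟩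
  letI : One (EngelGroup p) := ⟨![0, 0, 0, 0]⟩
  letI : Inv (EngelGroup p) := ⟨fun x =>
    ![-x 0, -x 1, -x 2 + x 0 * x 1, -x 3 + x 0 * x 2 - halfZp p * x 0 ^ 2 * x 1]⟩
  Group.ofLeftAxioms
    (by
      intro x y z
      have h := halfZp_mul_two p
      funext i
      fin_cases i
      · change x 0 + y 0 + z 0 = x 0 + (y 0 + z 0)
        ring
      · change x 1 + y 1 + z 1 = x 1 + (y 1 + z 1)
        ring
      · change (x 2 + y 2 + x 0 * y 1) + z 2 + (x 0 + y 0) * z 1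
          = x 2 + (y 2 + z 2 + y 0 * z 1) + x 0 * (y 1 + z 1)
        ring
      · change (x 3 + y 3 + x 0 * y 2 + halfZp p * x 0 ^ 2 * y 1) + z 3 + (x 0 + y 0) * z 2
            + halfZp p * (x 0 + y 0) ^ 2 * z 1
          = x 3 + (y 3 + z 3 + y 0 * z 2 + halfZp p * y 0 ^ 2 * z 1)
            + x 0 * (y 2 + z 2 + y 0 * z 1) + halfZp p * x 0 ^ 2 * (y 1 + z 1)
        linear_combination (x 0 * y 0 * z 1) * h)
    (by
      intro x
      funext i
      fin_cases i
      · change 0 + x 0 = x 0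
        ring
      · change 0 + x 1 = x 1
        ring
      · change 0 + x 2 + 0 * x 1 = x 2
        ring
      · change 0 + x 3 + 0 * x 2 + halfZp p * 0 ^ 2 * x 1 = x 3
        ring)
    (by
      intro x
      have h := halfZp_mul_two p
      funext i
      fin_cases i
      · change -x 0 + x 0 = 0
        ring
      · change -x 1 + x 1 = 0
        ring
      · change (-x 2 + x 0 * x 1) + x 2 + -x 0 * x 1 = 0
        ring
      · change (-x 3 + x 0 * x 2 - halfZp p * x 0 ^ 2 * x 1) + x 3 + -x 0 * x 2
          + halfZp p * (-x 0) ^ 2 * x 1 = 0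
        ring)

end Engel

section EngelDual

variable {p : ℕ} [Fact p.Prime]

variable (p) in
/-- The index set of the unitary dual of the Heisenberg group: the triples with
`(ξ₁, ξ₂) ∈ ℚ_p² / p ^ ϑ(ξ₃) ℤ_p²`, in the sense that the representatives of `ξ₁` and `ξ₂` belong to
the complete system of representatives of `ℚ_p / p ^ ϑ(ξ₃) ℤ_p`. The coordinates `ξ₁, ξ₂, ξ₃` are
`ξ 0, ξ 1, ξ 2`. -/
def heisenbergDual : Set (Fin 3 → ZpDual p) :=
  {ξ | (ξ 0).rep ∈ quotReps p (poleOrder (ξ 2).rep) ∧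
    (ξ 1).rep ∈ quotReps p (poleOrder (ξ 2).rep)}

variable (p) in
/-- The index set of the unitary dual of the Engel group. The coordinates `ξ₁, ξ₂, ξ₃, ξ₄` are
`ξ 0, ξ 1, ξ 2, ξ 3`. -/
def engelDual : Set (Fin 4 → ZpDual p) :=
  {ξ | (1 ≤ ‖(ξ 3).rep‖ ∧ ‖(ξ 3).rep‖ < ‖(ξ 2).rep‖ ∧ ![ξ 0, ξ 1, ξ 2] ∈ heisenbergDual p) ∨
    (‖(ξ 2).rep‖ = 1 ∧ (ξ 0).rep ∈ quotReps p (poleOrder (ξ 3).rep))}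

/-- `-ϑ(ξ₃, ξ₄) = -min (ϑ(ξ₃), ϑ(ξ₄))`. -/
def engelLevel (ξ : Fin 4 → ZpDual p) : ℕ := max (poleOrder (ξ 2).rep) (poleOrder (ξ 3).rep)

/-- `‖(ξ₃, ξ₄)‖_p = max (|ξ₃|_p, |ξ₄|_p)`. -/
def engelNorm (ξ : Fin 4 → ZpDual p) : ℝ := max ‖(ξ 2).rep‖ ‖(ξ 3).rep‖

/-- The function `φ_h = ‖(ξ₃, ξ₄)‖_p ^ (1/2) 1_{h + p ^ (-ϑ(ξ₃, ξ₄)) ℤ_p}` in `L²(ℤ_p)`. -/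
def engelBasis (ξ : Fin 4 → ZpDual p) (h : ZpMod p (engelLevel ξ)) : L2Zp p :=
  indicatorConstLp 2 (measurableSet_cosetZp h) (measure_ne_top (haarZp p) _)
    ((Real.sqrt (engelNorm ξ) : ℝ) : ℂ)

/-- The space `H_ξ`, the span of the functions `φ_h`. -/
def engelSpace (ξ : Fin 4 → ZpDual p) : Submodule ℂ (L2Zp p) :=
  Submodule.span ℂ (Set.range (engelBasis ξ))

instance instFiniteDimensionalEngelSpace (ξ : Fin 4 → ZpDual p) :
    FiniteDimensional ℂ (engelSpace ξ) :=
  FiniteDimensional.span_of_finite ℂ (Set.finite_range _)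

instance instCompleteSpaceEngelSpace (ξ : Fin 4 → ZpDual p) : CompleteSpace (engelSpace ξ) :=
  FiniteDimensional.complete ℂ _

/-- `φ_h` as an element of `H_ξ`. -/
def engelVec (ξ : Fin 4 → ZpDual p) (h : ZpMod p (engelLevel ξ)) : engelSpace ξ :=
  ⟨engelBasis ξ h, Submodule.subset_span ⟨h, rfl⟩⟩

/-- `ξ · x = ξ₁ x₁ + ξ₂ x₂ + ξ₃ x₃ + ξ₄ x₄`. -/
def engelDot (ξ : Fin 4 → ZpDual p) (x : EngelGroup p) : ℚ_[p] :=
  ∑ i : Fin 4, (ξ i).rep * (x i : ℚ_[p])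

/-- `(ξ₃ x₂ + ξ₄ x₃) u + ξ₄ x₂ u² / 2`. -/
def engelQuad (ξ : Fin 4 → ZpDual p) (x : EngelGroup p) (u : ℤ_[p]) : ℚ_[p] :=
  ((ξ 2).rep * (x 1 : ℚ_[p]) + (ξ 3).rep * (x 2 : ℚ_[p])) * (u : ℚ_[p])
    + (ξ 3).rep * (x 1 : ℚ_[p]) * ((u : ℚ_[p]) ^ 2 / 2)

/-- `ξ₁ x₁ + ξ₂ x₂ + ξ₃ (x₃ + u x₂) + ξ₄ (x₄ + u x₃ + (u² / 2) x₂)`. -/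
def engelPhase (ξ : Fin 4 → ZpDual p) (x : EngelGroup p) (u : ℤ_[p]) : ℚ_[p] :=
  (ξ 0).rep * (x 0 : ℚ_[p]) + (ξ 1).rep * (x 1 : ℚ_[p])
    + (ξ 2).rep * ((x 2 : ℚ_[p]) + (u : ℚ_[p]) * (x 1 : ℚ_[p]))
    + (ξ 3).rep * ((x 3 : ℚ_[p]) + (u : ℚ_[p]) * (x 2 : ℚ_[p])
      + (u : ℚ_[p]) ^ 2 / 2 * (x 1 : ℚ_[p]))

end EngelDual

end

/-!
The Engel group is a semidirect product of the abelian normal subgroup `N = {x₁ = 0}`, a copy of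
`ℤ_p³`, and the group `ℤ_p` of the elements `(a, 0, 0, 0)`, and the proof is the method of orbits
for this pair, carried out by hand.

*Finiteness.* For a strongly continuous unitary representation, the orbit of a non-zero vector `v`
under a small congruence subgroup stays near `v`; the vector of least norm in its closed convex hull
is fixed by that subgroup and is not zero (`exists_fixed_vector`). Congruence subgroups are normal
of finite index, so the orbit of the fixed vector spans a finite-dimensional space on which the
group acts through a finite quotient. In particular, irreducible representations are
finite-dimensional, and linear algebra provides eigenvectors.

*Orbits.* The element `(a, 0, 0, 0)` moves the character `(η₂, η₃, η₄)` of `N` to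
`(η₂ - a η₃ + a² η₄ / 2, η₃ - a η₄, η₄)`, modulo `ℤ_p³`. If `|η₃| ≤ |η₄|`, there is an `a` that
removes `η₃`; if `|η₄| < |η₃|`, the map `a ↦ a η₃ - a² η₄ / 2` is a bijection of `ℤ_p / p ^ m ℤ_p`
onto `p ^ (-m) ℤ_p / ℤ_p`, with `m = -ϑ(η₃)`, so that `η₂` can be brought into the chosen system of
representatives modulo `p ^ (-m) ℤ_p`. Thus the triples `(ξ₂, ξ₃, ξ₄)` of the index set represent
each orbit exactly once (`exists_isOrbitRep`, `IsOrbitRep.unique`), and the stabilizer of such a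
triple consists of the `x` with `x₁ ∈ p ^ (-ϑ(ξ₃, ξ₄)) ℤ_p`. A character of the stabilizer that
extends the given one is the choice of a class `ξ₁` modulo `p ^ ϑ(ξ₃, ξ₄) ℤ_p`.

*Engel vectors.* So every non-zero closed invariant subspace of a unitary representation contains a
non-zero vector on which the stabilizer acts through `x ↦ e^{2πi{ξ·x}_p}` for some `ξ` in the index
set (`exists_isEngelVector`). The matrix coefficient of such a vector vanishes off the stabilizer,
since vectors of different weights are orthogonal; it therefore depends on `ξ` only, and it
determines an irreducible representation (`UnitaryRep.equivalent_of_inner_eq`). On the other hand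
`H_ξ` contains such vectors for `ξ` alone, namely the multiples of `φ_0` (`eq_of_isEngelVector`).
These facts give the irreducibility of `π_ξ`, the completeness of the list, and the absence of
repetitions. The remaining assertions are computations in the basis `(φ_h)`, in which `π_ξ(x)` is a
translation of `ℤ_p / p ^ (-ϑ(ξ₃, ξ₄)) ℤ_p` followed by a unimodular multiplier.
-/

open MeasureTheory

noncomputable section

/-! ### Fractional parts and the character `e^{2πi{u}_p}` -/

section Fract

variable {p : ℕ} [Fact p.Prime]

theorem natCast_prime_ne_zero : (p : ℚ_[p]) ≠ 0 :=
  Nat.cast_ne_zero.2 (Fact.out : p.Prime).ne_zero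

theorem mem_padicIntSubgroup {u : ℚ_[p]} : u ∈ padicIntSubgroup p ↔ ‖u‖ ≤ 1 := Iff.rfl

theorem coe_mem_padicIntSubgroup (z : ℤ_[p]) : (z : ℚ_[p]) ∈ padicIntSubgroup p := z.2

theorem exists_coe_eq {u : ℚ_[p]} (hu : u ∈ padicIntSubgroup p) : ∃ z : ℤ_[p], (z : ℚ_[p]) = u :=
  ⟨⟨u, hu⟩, rfl⟩

theorem mul_coe_mem {u : ℚ_[p]} (hu : u ∈ padicIntSubgroup p) (z : ℤ_[p]) :
    u * z ∈ padicIntSubgroup p := by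
  obtain ⟨w, rfl⟩ := exists_coe_eq hu
  rw [← PadicInt.coe_mul]
  exact coe_mem_padicIntSubgroup _

/-- A rational number whose denominator is a power of `p` is an integer as soon as it is a
`p`-adic integer. -/
theorem exists_int_of_norm_le_one {q : ℚ} {a : ℤ} {n : ℕ} (hq : q * (p : ℚ) ^ n = a)
    (h : ‖(q : ℚ_[p])‖ ≤ 1) : ∃ k : ℤ, q = k := by
  have hp0 : (p : ℚ) ≠ 0 := Nat.cast_ne_zero.2 (Fact.out : p.Prime).ne_zero
  have h1 : ‖((a : ℤ) : ℚ_[p])‖ ≤ (p : ℝ) ^ (-(n : ℤ)) := by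
    have : ((a : ℤ) : ℚ_[p]) = (q : ℚ_[p]) * (p : ℚ_[p]) ^ n := by
      have := congrArg (fun r : ℚ => (r : ℚ_[p])) hq
      push_cast at this
      exact this.symm
    rw [this, norm_mul, norm_pow, Padic.norm_p, inv_pow, zpow_neg, zpow_natCast]
    exact mul_le_of_le_one_left (by positivity) h
  obtain ⟨k, hk⟩ := (Padic.norm_int_le_pow_iff_dvd a n).1 h1
  refine ⟨k, ?_⟩
  rw [hk] at hq
  have : (p : ℚ) ^ n ≠ 0 := pow_ne_zero _ hp0
  apply mul_right_cancel₀ this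
  rw [hq]
  push_cast
  ring

theorem exists_padicFract_eq (u : ℚ_[p]) :
    ∃ a n : ℕ, a < p ^ n ∧ padicFract u = (a : ℚ) / (p : ℚ) ^ n := by
  have : NeZero (p ^ poleOrder u) := ⟨pow_ne_zero _ (Fact.out : p.Prime).ne_zero⟩
  exact ⟨_, poleOrder u, ZMod.val_lt _, rfl⟩

theorem sub_padicFract_mem (u : ℚ_[p]) : u - (padicFract u : ℚ) ∈ padicIntSubgroup p := by
  set n := poleOrder u with hn
  have : NeZero (p ^ n) := ⟨pow_ne_zero _ (Fact.out : p.Prime).ne_zero⟩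
  set a := (PadicInt.toZModPow n (clearPole u)).val with ha
  have hmem : clearPole u - (a : ℤ_[p]) ∈ Ideal.span {(p : ℤ_[p]) ^ n} := by
    rw [← PadicInt.ker_toZModPow, RingHom.mem_ker, map_sub, map_natCast, ha,
      ZMod.natCast_zmod_val, sub_self]
  obtain ⟨w, hw⟩ := Ideal.mem_span_singleton.1 hmem
  have h2 : u * (p : ℚ_[p]) ^ n - (a : ℚ_[p]) = (p : ℚ_[p]) ^ n * w := by
    have := congrArg (fun z : ℤ_[p] => (z : ℚ_[p])) hw
    simpa [coe_clearPole] using this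
  have h3 : u - (padicFract u : ℚ) = (w : ℚ_[p]) := by
    have hp : (p : ℚ_[p]) ^ n ≠ 0 := pow_ne_zero _ natCast_prime_ne_zero
    have : padicFract u = (a : ℚ) / (p : ℚ) ^ n := rfl
    rw [this]
    push_cast
    field_simp
    linear_combination h2
  rw [h3]
  exact w.2

theorem padicFract_nonneg (u : ℚ_[p]) : 0 ≤ padicFract u := by
  unfold padicFract
  positivity

theorem padicFract_lt_one (u : ℚ_[p]) : padicFract u < 1 := by
  obtain ⟨a, n, han, h⟩ := exists_padicFract_eq u
  have : (0 : ℚ) < (p : ℚ) ^ n := pow_pos (Nat.cast_pos.2 (Fact.out : p.Prime).pos) n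
  rw [h, div_lt_one this]
  exact_mod_cast han

/-- The number `a / p ^ n` in `[0, 1)` is its own fractional part. -/
theorem padicFract_ratCast {a n : ℕ} (han : a < p ^ n) :
    padicFract ((((a : ℚ) / (p : ℚ) ^ n : ℚ) : ℚ_[p])) = (a : ℚ) / (p : ℚ) ^ n := by
  set q : ℚ := (a : ℚ) / (p : ℚ) ^ n with hq
  have hp0 : (p : ℚ) ≠ 0 := Nat.cast_ne_zero.2 (Fact.out : p.Prime).ne_zero
  have hpn : (0 : ℚ) < (p : ℚ) ^ n := pow_pos (Nat.cast_pos.2 (Fact.out : p.Prime).pos) n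
  obtain ⟨b, m, hbm, hb⟩ := exists_padicFract_eq ((q : ℚ) : ℚ_[p])
  have hint : ∃ k : ℤ, q - padicFract ((q : ℚ) : ℚ_[p]) = k := by
    refine exists_int_of_norm_le_one (p := p) (a := a * (p : ℤ) ^ m - b * (p : ℤ) ^ n)
      (n := n + m) ?_ ?_
    · rw [hb, hq]
      push_cast
      field_simp
      ring
    · push_cast
      exact sub_padicFract_mem _
  obtain ⟨k, hk⟩ := hint
  have h1 := padicFract_nonneg ((q : ℚ) : ℚ_[p])
  have h2 := padicFract_lt_one ((q : ℚ) : ℚ_[p])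
  have h3 : 0 ≤ q := by positivity
  have h4 : q < 1 := by
    rw [hq, div_lt_one hpn]
    exact_mod_cast han
  have h5 : (-1 : ℚ) < k := by linarith
  have h6 : (k : ℚ) < 1 := by linarith
  have h7 : k = 0 := by
    have : (-1 : ℤ) < k := by exact_mod_cast h5
    have : k < 1 := by exact_mod_cast h6
    omega
  rw [h7] at hk
  push_cast at hk
  linarith

theorem padicFract_eq_zero_iff {u : ℚ_[p]} : padicFract u = 0 ↔ u ∈ padicIntSubgroup p := by
  refine ⟨fun h => ?_, fun h => padicFract_eq_zero h⟩
  have := sub_padicFract_mem u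
  rwa [h, Rat.cast_zero, sub_zero] at this

theorem exp_int_mul_two_pi (q : ℚ) (k : ℤ) (h : q = k) :
    Complex.exp (2 * (Real.pi : ℂ) * Complex.I * (q : ℂ)) = 1 := by
  rw [h, Complex.exp_eq_one_iff]
  exact ⟨k, by push_cast; ring⟩

theorem padicExp_add (u v : ℚ_[p]) : padicExp (u + v) = padicExp u * padicExp v := by
  have hp0 : (p : ℚ) ≠ 0 := Nat.cast_ne_zero.2 (Fact.out : p.Prime).ne_zero
  obtain ⟨a, n, -, ha⟩ := exists_padicFract_eq u
  obtain ⟨b, m, -, hb⟩ := exists_padicFract_eq v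
  obtain ⟨c, l, -, hc⟩ := exists_padicFract_eq (u + v)
  obtain ⟨k, hk⟩ : ∃ k : ℤ, padicFract (u + v) - padicFract u - padicFract v = k := by
    refine exists_int_of_norm_le_one (p := p) (n := n + m + l)
      (a := c * (p : ℤ) ^ (n + m) - a * (p : ℤ) ^ (m + l) - b * (p : ℤ) ^ (n + l)) ?_ ?_
    · rw [ha, hb, hc]
      push_cast
      field_simp
      ring
    · have h := (padicIntSubgroup p).sub_mem (add_mem (sub_padicFract_mem u)
        (sub_padicFract_mem v)) (sub_padicFract_mem (u + v))
      push_cast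
      rw [← mem_padicIntSubgroup]
      convert h using 1
      ring
  have h1 := exp_int_mul_two_pi _ k hk
  have h2 : ((padicFract (u + v) : ℚ) : ℂ) = (padicFract u : ℂ) + (padicFract v : ℂ)
      + ((padicFract (u + v) - padicFract u - padicFract v : ℚ) : ℂ) := by
    push_cast
    ring
  rw [padicExp, padicExp, padicExp, h2, mul_add, mul_add, Complex.exp_add, Complex.exp_add, h1,
    mul_one]

theorem padicExp_of_mem {u : ℚ_[p]} (hu : u ∈ padicIntSubgroup p) : padicExp u = 1 := by
  simp [padicExp, padicFract_eq_zero_iff.2 hu]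

theorem padicExp_congr {u v : ℚ_[p]} (h : u - v ∈ padicIntSubgroup p) :
    padicExp u = padicExp v := by
  simp only [padicExp, padicFract_congr (mem_padicIntSubgroup.1 h)]

theorem padicExp_zero : padicExp (0 : ℚ_[p]) = 1 := padicExp_of_mem (zero_mem _)

theorem padicExp_eq_one_iff {u : ℚ_[p]} : padicExp u = 1 ↔ u ∈ padicIntSubgroup p := by
  refine ⟨fun h => ?_, padicExp_of_mem⟩
  rw [padicExp, Complex.exp_eq_one_iff] at h
  obtain ⟨k, hk⟩ := h
  have h0 : (2 * (Real.pi : ℂ) * Complex.I) ≠ 0 := Complex.two_pi_I_ne_zero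
  have h1 : ((padicFract u : ℚ) : ℂ) = (k : ℂ) := by
    apply mul_left_cancel₀ h0
    rw [hk]
    ring
  have h2 : padicFract u = (k : ℚ) := by exact_mod_cast h1
  have h3 := padicFract_nonneg u
  have h4 := padicFract_lt_one u
  rw [h2] at h3 h4
  have h5 : (0 : ℤ) ≤ k := by exact_mod_cast h3
  have h6 : k < 1 := by exact_mod_cast h4
  have h7 : k = 0 := by omega
  rw [h7, Int.cast_zero] at h2
  exact padicFract_eq_zero_iff.1 h2

theorem padicExp_ne_zero (u : ℚ_[p]) : padicExp u ≠ 0 := Complex.exp_ne_zero _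

theorem norm_padicExp (u : ℚ_[p]) : ‖padicExp u‖ = 1 := by
  have : 2 * (Real.pi : ℂ) * Complex.I * ((padicFract u : ℚ) : ℂ)
      = ((2 * Real.pi * (padicFract u : ℝ) : ℝ) : ℂ) * Complex.I := by
    push_cast
    ring
  rw [padicExp, this, Complex.norm_exp_ofReal_mul_I]

theorem padicExp_eq_iff {u v : ℚ_[p]} :
    padicExp u = padicExp v ↔ u - v ∈ padicIntSubgroup p := by
  refine ⟨fun h => ?_, padicExp_congr⟩
  have h1 : u = (u - v) + v := by ring
  rw [← padicExp_eq_one_iff]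
  rw [h1, padicExp_add] at h
  exact mul_right_cancel₀ (padicExp_ne_zero v) (by rw [h, one_mul])

/-- Two characters of `ℤ_p` given by elements of `ℚ_p` agree only if these differ by a `p`-adic
integer. -/
theorem sub_mem_of_forall_padicExp_eq {a b : ℚ_[p]}
    (h : ∀ z : ℤ_[p], padicExp (a * (z : ℚ_[p]))
      = padicExp (b * (z : ℚ_[p]))) : a - b ∈ padicIntSubgroup p := by
  have := h 1
  rwa [PadicInt.coe_one, mul_one, mul_one, padicExp_eq_iff] at this

theorem padicExp_nsmul (u : ℚ_[p]) (j : ℕ) : padicExp (u * (j : ℚ_[p])) = padicExp u ^ j := by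
  induction j with
  | zero => simp [padicExp_zero]
  | succ j ih => rw [Nat.cast_succ, mul_add, mul_one, padicExp_add, ih, pow_succ]

theorem continuous_padicExp : Continuous (padicExp : ℚ_[p] → ℂ) := by
  apply IsLocallyConstant.continuous
  rw [IsLocallyConstant.iff_eventually_eq]
  intro u
  filter_upwards [Metric.closedBall_mem_nhds u one_pos] with v hv
  apply padicExp_congr
  rw [mem_padicIntSubgroup, ← dist_eq_norm]
  exact hv

/-- The `p ^ n`-th roots of unity are values of the character. -/
theorem exists_padicExp_of_pow_eq_one {μ : ℂ} {n : ℕ} (h : μ ^ p ^ n = 1) :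
    ∃ η : ℚ_[p], η * (p : ℚ_[p]) ^ n ∈ padicIntSubgroup p ∧ padicExp η = μ := by
  have hpn : p ^ n ≠ 0 := pow_ne_zero _ (Fact.out : p.Prime).ne_zero
  have : NeZero (p ^ n) := ⟨hpn⟩
  obtain ⟨i, hi, rfl⟩ := (Complex.isPrimitiveRoot_exp _ hpn).eq_pow_of_pow_eq_one h
  refine ⟨(((i : ℚ) / (p : ℚ) ^ n : ℚ) : ℚ_[p]), ?_, ?_⟩
  · have hp : (p : ℚ_[p]) ^ n ≠ 0 := pow_ne_zero _ natCast_prime_ne_zero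
    push_cast
    rw [div_mul_cancel₀ _ hp]
    exact coe_mem_padicIntSubgroup (i : ℤ_[p])
  · rw [padicExp, padicFract_ratCast hi, ← Complex.exp_nat_mul]
    congr 1
    push_cast
    ring

end Fract

/-! ### Representatives of `ℚ_p / ℤ_p` and of `ℚ_p / p ^ (-n) ℤ_p` -/

section Rep

variable {p : ℕ} [Fact p.Prime]

theorem ZpDual.fract_mk (u : ℚ_[p]) : ZpDual.fract (u : ZpDual p) = padicFract u := rfl

theorem ZpDual.mk_eq_mk_iff {u v : ℚ_[p]} :
    (u : ZpDual p) = (v : ZpDual p) ↔ u - v ∈ padicIntSubgroup p := by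
  rw [← sub_eq_zero, ← QuotientAddGroup.mk_sub, QuotientAddGroup.eq_zero_iff]

theorem ZpDual.rep_of_ne_zero {l : ZpDual p} (h : l ≠ 0) : l.rep = (l.fract : ℚ) := if_neg h

theorem ZpDual.mk_rep (l : ZpDual p) : ((l.rep : ℚ_[p]) : ZpDual p) = l := by
  by_cases h : l = 0
  · rw [h, ZpDual.rep, if_pos rfl, QuotientAddGroup.eq_zero_iff]
    exact coe_mem_padicIntSubgroup (1 : ℤ_[p])
  · rw [ZpDual.rep_of_ne_zero h]
    obtain ⟨u, rfl⟩ := QuotientAddGroup.mk_surjective l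
    rw [ZpDual.fract_mk, eq_comm, ZpDual.mk_eq_mk_iff]
    exact sub_padicFract_mem u

theorem ZpDual.rep_mk_sub_mem (u : ℚ_[p]) :
    ZpDual.rep (u : ZpDual p) - u ∈ padicIntSubgroup p := by
  rw [← ZpDual.mk_eq_mk_iff, ZpDual.mk_rep]

theorem ZpDual.rep_zero : ZpDual.rep (0 : ZpDual p) = 1 := by simp [ZpDual.rep]

theorem ZpDual.rep_mem_iff {l : ZpDual p} : l.rep ∈ padicIntSubgroup p ↔ l = 0 := by
  rw [← QuotientAddGroup.eq_zero_iff, ZpDual.mk_rep]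

theorem ZpDual.eq_of_rep_sub_mem {l l' : ZpDual p} (h : l.rep - l'.rep ∈ padicIntSubgroup p) :
    l = l' := by
  rw [← ZpDual.mk_rep l, ← ZpDual.mk_rep l', ZpDual.mk_eq_mk_iff]
  exact h

theorem ZpDual.one_le_norm_rep (l : ZpDual p) : 1 ≤ ‖l.rep‖ := by
  by_cases h : l = 0
  · simp [h, ZpDual.rep_zero]
  · have := mt ZpDual.rep_mem_iff.1 h
    rw [mem_padicIntSubgroup, not_le] at this
    exact this.le

theorem ZpDual.rep_ne_zero (l : ZpDual p) : l.rep ≠ 0 := by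
  have := l.one_le_norm_rep
  intro h
  rw [h, norm_zero] at this
  linarith

theorem ZpDual.norm_rep_eq_one_iff {l : ZpDual p} : ‖l.rep‖ = 1 ↔ l = 0 := by
  rw [← ZpDual.rep_mem_iff, mem_padicIntSubgroup]
  exact ⟨fun h => h.le, fun h => le_antisymm h l.one_le_norm_rep⟩

theorem ZpDual.norm_rep (l : ZpDual p) : ‖l.rep‖ = (p : ℝ) ^ poleOrder l.rep := by
  have hp : (1 : ℝ) < p := by exact_mod_cast (Fact.out : p.Prime).one_lt
  have h1 := l.one_le_norm_rep
  have h := Padic.norm_eq_zpow_neg_valuation l.rep_ne_zero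
  have h2 : 0 ≤ -l.rep.valuation := by
    rw [h] at h1
    exact (one_le_zpow_iff_right₀ hp).1 h1
  rw [h, ← zpow_natCast]
  unfold poleOrder
  rw [Int.toNat_of_nonneg h2]

theorem ZpDual.rep_mul_mem_iff (l : ZpDual p) (z : ℤ_[p]) :
    l.rep * z ∈ padicIntSubgroup p ↔ (p : ℤ_[p]) ^ poleOrder l.rep ∣ z := by
  have hp : (0 : ℝ) < p := by exact_mod_cast (Fact.out : p.Prime).pos
  rw [mem_padicIntSubgroup, norm_mul, l.norm_rep, ← Ideal.mem_span_singleton,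
    ← PadicInt.norm_le_pow_iff_mem_span_pow, zpow_neg, zpow_natCast, PadicInt.norm_def,
    ← one_div, le_div_iff₀ (pow_pos hp _), mul_comm]

/-- The numbers `a / p ^ N` with `a < p ^ N` are the sums `∑_{1 ≤ k ≤ N} λ_k p ^ (-k)`. -/
theorem exists_digits_iff (N : ℕ) (q : ℚ) :
    (∃ a < p ^ N, q = (a : ℚ) / (p : ℚ) ^ N) ↔
      ∃ c : ℕ → ℕ, (∀ k, c k < p) ∧ q = ∑ k ∈ Finset.range N, (c k : ℚ) / (p : ℚ) ^ (k + 1) := by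
  have hp := (Fact.out : p.Prime).pos
  have hp0 : (p : ℚ) ≠ 0 := Nat.cast_ne_zero.2 hp.ne'
  constructor
  · rintro ⟨a, ha, rfl⟩
    induction N generalizing a with
    | zero =>
      have : a = 0 := by simpa using ha
      exact ⟨fun _ => 0, fun _ => hp, by simp [this]⟩
    | succ N ih =>
      have h1 : a / p < p ^ N := by
        rw [Nat.div_lt_iff_lt_mul hp, ← pow_succ]
        exact ha
      obtain ⟨c, hc, hs⟩ := ih _ h1
      refine ⟨Function.update c N (a % p), fun k => ?_, ?_⟩
      · rcases eq_or_ne k N with rfl | hk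
        · simpa using Nat.mod_lt _ hp
        · simpa [hk] using hc k
      · rw [Finset.sum_range_succ, Function.update_self]
        have h2 : ∑ k ∈ Finset.range N, (Function.update c N (a % p) k : ℚ) / (p : ℚ) ^ (k + 1)
            = ∑ k ∈ Finset.range N, (c k : ℚ) / (p : ℚ) ^ (k + 1) := by
          refine Finset.sum_congr rfl fun k hk => ?_
          rw [Function.update_of_ne (Finset.mem_range.1 hk).ne]
        rw [h2, ← hs]
        have h3 : (a : ℚ) = p * (a / p : ℕ) + (a % p : ℕ) := by
          exact_mod_cast (Nat.div_add_mod a p).symm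
        rw [h3]
        field_simp
        ring
  · rintro ⟨c, hc, rfl⟩
    induction N with
    | zero => exact ⟨0, by simp, by simp⟩
    | succ N ih =>
      obtain ⟨a, ha, hs⟩ := ih
      refine ⟨p * a + c N, ?_, ?_⟩
      · have := hc N
        calc p * a + c N < p * (a + 1) := by rw [mul_add, mul_one]; omega
          _ ≤ p * p ^ N := Nat.mul_le_mul_left _ ha
          _ = p ^ (N + 1) := by ring
      · rw [Finset.sum_range_succ, hs]
        push_cast
        field_simp
        ring

theorem exists_digits_quotReps_iff (n : ℕ) (r : ℚ_[p]) :
    (∃ c : ℕ →₀ ℕ, c ≠ 0 ∧ (∀ k, c k < p) ∧ (∀ k ≤ n, c k = 0) ∧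
      r = c.sum fun k d => (d : ℚ_[p]) * (p : ℚ_[p]) ^ (-(k : ℤ))) ↔
    ∃ a N : ℕ, 0 < a ∧ a < p ^ N ∧
      r * (p : ℚ_[p]) ^ n = (((a : ℚ) / (p : ℚ) ^ N : ℚ) : ℚ_[p]) := by
  have hp := (Fact.out : p.Prime).pos
  have hp0 : (p : ℚ) ≠ 0 := Nat.cast_ne_zero.2 hp.ne'
  have hpQ : (p : ℚ_[p]) ≠ 0 := natCast_prime_ne_zero
  have key : ∀ (c : ℕ →₀ ℕ) (N : ℕ), (∀ k ≤ n, c k = 0) → c.support ⊆ Finset.range (n + 1 + N) →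
      (c.sum fun k d => (d : ℚ_[p]) * (p : ℚ_[p]) ^ (-(k : ℤ))) * (p : ℚ_[p]) ^ n
        = ((∑ k ∈ Finset.range N, (c (n + 1 + k) : ℚ) / (p : ℚ) ^ (k + 1) : ℚ) : ℚ_[p]) := by
    intro c N hc0 hN
    rw [Finsupp.sum_of_support_subset c hN _ (by simp), Finset.sum_range_add,
      Finset.sum_eq_zero (s := Finset.range (n + 1)), zero_add, Finset.sum_mul]
    · push_cast
      refine Finset.sum_congr rfl fun k _ => ?_
      rw [zpow_neg, ← Nat.cast_one (R := ℤ), ← Nat.cast_add, ← Nat.cast_add, zpow_natCast]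
      field_simp
      ring
    · intro k hk
      rw [hc0 k (by simpa [Nat.lt_succ_iff] using hk)]
      simp
  constructor
  · rintro ⟨c, hc, hcp, hc0, rfl⟩
    obtain ⟨N, hN⟩ : ∃ N, c.support ⊆ Finset.range (n + 1 + N) := by
      obtain ⟨M, hM⟩ := c.support.exists_nat_subset_range
      exact ⟨M, hM.trans (Finset.range_mono (by omega))⟩
    obtain ⟨a, ha, hs⟩ := (exists_digits_iff N _).2 ⟨fun k => c (n + 1 + k), fun k => hcp _, rfl⟩
    refine ⟨a, N, Nat.pos_of_ne_zero ?_, ha, ?_⟩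
    · rintro rfl
      apply hc
      rw [Nat.cast_zero, zero_div, Finset.sum_eq_zero_iff_of_nonneg (fun k _ => by positivity)]
        at hs
      ext k
      by_contra hk
      have h1 := hN (Finsupp.mem_support_iff.2 hk)
      have h2 : n < k := by
        by_contra h
        exact hk (hc0 k (by omega))
      have h3 := hs (k - (n + 1)) (by simp at h1 ⊢; omega)
      have h4 : n + 1 + (k - (n + 1)) = k := by omega
      simp only [h4] at h3
      rw [div_eq_zero_iff] at h3
      rcases h3 with h3 | h3
      · exact hk (by exact_mod_cast h3)
      · exact pow_ne_zero _ hp0 h3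
    · rw [key c N hc0 hN, hs]
  · rintro ⟨a, N, ha0, ha, hr⟩
    obtain ⟨c, hcp, hs⟩ := (exists_digits_iff N _).1 ⟨a, ha, rfl⟩
    let c' : ℕ →₀ ℕ := Finsupp.onFinset (Finset.range (n + 1 + N))
      (fun k => if n + 1 ≤ k ∧ k < n + 1 + N then c (k - (n + 1)) else 0) (by
        intro k hk
        by_contra h
        apply hk
        rw [if_neg]
        simpa using fun _ => h)
    have hc' : ∀ k, c' k = if n + 1 ≤ k ∧ k < n + 1 + N then c (k - (n + 1)) else 0 := fun _ => rfl
    have hc0 : ∀ k ≤ n, c' k = 0 := by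
      intro k hk
      rw [hc', if_neg (by omega)]
    have hval : (c'.sum fun k d => (d : ℚ_[p]) * (p : ℚ_[p]) ^ (-(k : ℤ))) * (p : ℚ_[p]) ^ n
        = (((a : ℚ) / (p : ℚ) ^ N : ℚ) : ℚ_[p]) := by
      rw [key c' N hc0 Finsupp.support_onFinset_subset, hs]
      congr 1
      refine Finset.sum_congr rfl fun k hk => ?_
      have hk' := Finset.mem_range.1 hk
      rw [hc', if_pos (by omega), Nat.add_sub_cancel_left]
    refine ⟨c', ?_, ?_, hc0, ?_⟩
    · intro h
      rw [h, Finsupp.sum_zero_index, zero_mul] at hval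
      have h1 : (0 : ℚ) = (a : ℚ) / (p : ℚ) ^ N := by exact_mod_cast hval
      have h2 : (0 : ℚ) < (a : ℚ) / (p : ℚ) ^ N := by positivity
      exact h2.ne h1
    · intro k
      rw [hc']
      split_ifs
      · exact hcp _
      · exact hp
    · exact mul_right_cancel₀ (pow_ne_zero n hpQ) (hr.trans hval.symm)

/-- Every class of `ℚ_p / p ^ (-n) ℤ_p` has a representative in the complete system. -/
theorem exists_rep_mem_quotReps (n : ℕ) (η : ℚ_[p]) :
    ∃ l : ZpDual p, l.rep ∈ quotReps p n ∧
      (l.rep - η) * (p : ℚ_[p]) ^ n ∈ padicIntSubgroup p := by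
  have hp0 : (p : ℚ) ≠ 0 := Nat.cast_ne_zero.2 (Fact.out : p.Prime).ne_zero
  have hpQ : (p : ℚ_[p]) ≠ 0 := natCast_prime_ne_zero
  set v := η * (p : ℚ_[p]) ^ n with hv
  obtain ⟨a, N, ha, hf⟩ := exists_padicFract_eq v
  have hvf := sub_padicFract_mem v
  have hpn : ((p : ℤ_[p]) : ℚ_[p]) = p := by simp
  rcases Nat.eq_zero_or_pos a with rfl | ha0
  · refine ⟨0, Or.inl ZpDual.rep_zero, ?_⟩
    rw [hf, Nat.cast_zero, zero_div, Rat.cast_zero, sub_zero] at hvf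
    rw [ZpDual.rep_zero, sub_mul, one_mul]
    refine sub_mem ?_ hvf
    rw [← hpn, ← PadicInt.coe_pow]
    exact coe_mem_padicIntSubgroup _
  · set q : ℚ := (a : ℚ) / (p : ℚ) ^ (N + n) with hq
    have han : a < p ^ (N + n) :=
      ha.trans_le (Nat.pow_le_pow_right (Fact.out : p.Prime).pos (by omega))
    have hqf : padicFract ((q : ℚ) : ℚ_[p]) = q := padicFract_ratCast han
    have hq0 : q ≠ 0 := by positivity
    set l : ZpDual p := (((q : ℚ) : ℚ_[p]) : ZpDual p) with hl
    have hl0 : l ≠ 0 := by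
      intro h
      rw [hl, QuotientAddGroup.eq_zero_iff, ← padicFract_eq_zero_iff, hqf] at h
      exact hq0 h
    have hrep : l.rep = (q : ℚ_[p]) := by
      rw [ZpDual.rep_of_ne_zero hl0, hl, ZpDual.fract_mk, hqf]
    have hmul : l.rep * (p : ℚ_[p]) ^ n = (((a : ℚ) / (p : ℚ) ^ N : ℚ) : ℚ_[p]) := by
      rw [hrep, hq]
      push_cast
      rw [pow_add]
      field_simp
    refine ⟨l, Or.inr ((exists_digits_quotReps_iff n _).2 ⟨a, N, ha0, ha, hmul⟩), ?_⟩
    rw [sub_mul, hmul, ← hf, ← neg_sub]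
    exact neg_mem hvf

/-- The representatives in the complete system of `ℚ_p / p ^ (-n) ℤ_p` are pairwise
incongruent. -/
theorem eq_of_rep_mem_quotReps {n : ℕ} {l l' : ZpDual p} (hl : l.rep ∈ quotReps p n)
    (hl' : l'.rep ∈ quotReps p n)
    (h : (l.rep - l'.rep) * (p : ℚ_[p]) ^ n ∈ padicIntSubgroup p) : l = l' := by
  have hpQ : (p : ℚ_[p]) ≠ 0 := natCast_prime_ne_zero
  -- the scaled representative is an integer for the trivial class, a proper fraction otherwise
  have key : ∀ l : ZpDual p, l.rep ∈ quotReps p n →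
      (l = 0 ∧ padicFract (l.rep * (p : ℚ_[p]) ^ n) = 0) ∨
      (padicFract (l.rep * (p : ℚ_[p]) ^ n) ≠ 0 ∧
        l.rep * (p : ℚ_[p]) ^ n = (padicFract (l.rep * (p : ℚ_[p]) ^ n) : ℚ)) := by
    rintro l (h | h)
    · have h1 : l = 0 := by
        rw [← ZpDual.rep_mem_iff, Set.mem_singleton_iff.1 h]
        exact coe_mem_padicIntSubgroup (1 : ℤ_[p])
      refine Or.inl ⟨h1, ?_⟩
      rw [padicFract_eq_zero_iff, Set.mem_singleton_iff.1 h, one_mul]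
      have := coe_mem_padicIntSubgroup ((p : ℤ_[p]) ^ n)
      simpa using this
    · obtain ⟨a, N, ha0, ha, hr⟩ := (exists_digits_quotReps_iff n _).1 h
      refine Or.inr ?_
      have hp := (Fact.out : p.Prime).pos
      rw [hr, padicFract_ratCast ha]
      exact ⟨by positivity, rfl⟩
  have hf : padicFract (l.rep * (p : ℚ_[p]) ^ n) = padicFract (l'.rep * (p : ℚ_[p]) ^ n) := by
    apply padicFract_congr
    rwa [← sub_mul]
  rcases key l hl with ⟨h1, h2⟩ | ⟨h1, h2⟩ <;> rcases key l' hl' with ⟨h3, h4⟩ | ⟨h3, h4⟩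
  · rw [h1, h3]
  · exact absurd (hf.symm.trans h2) h3
  · exact absurd (hf.trans h4) h1
  · apply ZpDual.eq_of_rep_sub_mem
    have : l.rep = l'.rep := by
      apply mul_right_cancel₀ (pow_ne_zero n hpQ)
      rw [h2, h4, hf]
    rw [this, sub_self]
    exact zero_mem _

end Rep

/-! ### Haar measure on cosets and step functions on `ℤ_p` -/

section Cosets

variable {p : ℕ} [Fact p.Prime]

instance instFintypeZpMod (n : ℕ) : Fintype (ZpMod p n) := Fintype.ofFinite _

theorem card_ZpMod (n : ℕ) : Fintype.card (ZpMod p n) = p ^ n := by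
  have h : Nat.card (ℤ_[p] ⧸ RingHom.ker (PadicInt.toZModPow (p := p) n)) = p ^ n := by
    rw [Nat.card_congr (RingHom.quotientKerEquivOfSurjective
      (ZMod.ringHom_surjective (PadicInt.toZModPow (p := p) n))).toEquiv, Nat.card_zmod]
  rw [PadicInt.ker_toZModPow] at h
  rw [← Nat.card_eq_fintype_card, ← h]

theorem mk_eq_zero_iff {n : ℕ} {a : ℤ_[p]} :
    (Ideal.Quotient.mk _ a : ZpMod p n) = 0 ↔ (p : ℤ_[p]) ^ n ∣ a := by
  rw [Ideal.Quotient.eq_zero_iff_mem, Ideal.mem_span_singleton]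

theorem mk_eq_mk_iff {n : ℕ} {a b : ℤ_[p]} :
    (Ideal.Quotient.mk _ a : ZpMod p n) = Ideal.Quotient.mk _ b ↔ (p : ℤ_[p]) ^ n ∣ a - b := by
  rw [Ideal.Quotient.eq, Ideal.mem_span_singleton]

instance instIsAddHaarMeasureHaarZp : (haarZp p).IsAddHaarMeasure := by
  unfold haarZp
  infer_instance

theorem mem_cosetZp {n : ℕ} {h : ZpMod p n} {u : ℤ_[p]} :
    u ∈ cosetZp h ↔ Ideal.Quotient.mk _ u = h := Iff.rfl

theorem haarZp_real_cosetZp_eq {n : ℕ} (h : ZpMod p n) :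
    (haarZp p).real (cosetZp h) = (haarZp p).real (cosetZp (0 : ZpMod p n)) := by
  obtain ⟨a, rfl⟩ := Ideal.Quotient.mk_surjective h
  have : cosetZp (0 : ZpMod p n)
      = (fun u => a + u) ⁻¹' cosetZp (Ideal.Quotient.mk _ a : ZpMod p n) := by
    ext u
    simp [mem_cosetZp]
  rw [this, Measure.real, Measure.real, measure_preimage_add]

theorem sum_indicator_cosetZp {n : ℕ} (F : ZpMod p n → ℂ) (u : ℤ_[p]) :
    ∑ h, (cosetZp h).indicator (fun _ => F h) u = F (Ideal.Quotient.mk _ u) := by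
  classical
  rw [Finset.sum_eq_single (Ideal.Quotient.mk _ u)]
  · exact Set.indicator_of_mem rfl _
  · intro h _ hh
    exact Set.indicator_of_notMem (fun hu => hh hu.symm) _
  · simp

theorem integral_step_aux {n : ℕ} (F : ZpMod p n → ℂ) :
    ∫ u : ℤ_[p], F (Ideal.Quotient.mk _ u) ∂(haarZp p)
      = (haarZp p).real (cosetZp (0 : ZpMod p n)) * ∑ h, F h := by
  have h1 : (fun u : ℤ_[p] => F (Ideal.Quotient.mk _ u))
      = fun u => ∑ h, (cosetZp h).indicator (fun _ => F h) u := by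
    funext u
    rw [sum_indicator_cosetZp]
  rw [h1, integral_finsetSum]
  · rw [Finset.mul_sum]
    refine Finset.sum_congr rfl fun h _ => ?_
    rw [integral_indicator_const _ (measurableSet_cosetZp h), haarZp_real_cosetZp_eq,
      Complex.real_smul]
  · intro h _
    exact (integrable_const _).indicator (measurableSet_cosetZp h)

theorem haarZp_real_cosetZp {n : ℕ} (h : ZpMod p n) :
    (haarZp p).real (cosetZp h) = ((p : ℝ) ^ n)⁻¹ := by
  have h1 := integral_step_aux (p := p) (n := n) (fun _ => 1)
  rw [integral_const, Finset.sum_const, Finset.card_univ, card_ZpMod, probReal_univ, one_smul,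
    nsmul_eq_mul, mul_one] at h1
  have h2 : (1 : ℝ) = (haarZp p).real (cosetZp (0 : ZpMod p n)) * (p : ℝ) ^ n := by
    exact_mod_cast h1
  rw [haarZp_real_cosetZp_eq]
  exact eq_inv_of_mul_eq_one_left h2.symm

/-- The integral of a function on `ℤ_p` that factors through `ℤ_p / p ^ n ℤ_p`. -/
theorem integral_step {n : ℕ} (F : ZpMod p n → ℂ) :
    ∫ u : ℤ_[p], F (Ideal.Quotient.mk _ u) ∂(haarZp p) = ((p : ℂ) ^ n)⁻¹ * ∑ h, F h := by
  rw [integral_step_aux, haarZp_real_cosetZp]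
  push_cast
  rfl

theorem disjoint_cosetZp {n : ℕ} {h h' : ZpMod p n} (hh : h ≠ h') :
    cosetZp h ∩ cosetZp h' = ∅ := by
  ext u
  simp only [Set.mem_inter_iff, mem_cosetZp, Set.mem_empty_iff_false, iff_false, not_and]
  rintro rfl h2
  exact hh h2

theorem continuous_comp_mk {n : ℕ} (F : ZpMod p n → ℂ) :
    Continuous fun u : ℤ_[p] => F (Ideal.Quotient.mk _ u) := by
  apply IsLocallyConstant.continuous
  rw [IsLocallyConstant.iff_eventually_eq]
  intro u
  have hp : (0 : ℝ) < (p : ℝ) ^ (-(n : ℤ)) :=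
    zpow_pos (by exact_mod_cast (Fact.out : p.Prime).pos) _
  filter_upwards [Metric.closedBall_mem_nhds u hp] with v hv
  have : (Ideal.Quotient.mk _ v : ZpMod p n) = Ideal.Quotient.mk _ u := by
    rw [Ideal.Quotient.eq, ← PadicInt.norm_le_pow_iff_mem_span_pow, ← dist_eq_norm]
    exact hv
  rw [this]

end Cosets

/-! ### The space `H_ξ` and its orthonormal basis -/

section Space

variable {p : ℕ} [Fact p.Prime]

theorem engelNorm_eq (ξ : Fin 4 → ZpDual p) : engelNorm ξ = (p : ℝ) ^ engelLevel ξ := by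
  have hp : (1 : ℝ) ≤ p := by exact_mod_cast (Fact.out : p.Prime).one_lt.le
  rw [engelNorm, engelLevel, ZpDual.norm_rep, ZpDual.norm_rep]
  exact ((pow_right_mono₀ hp).map_max).symm

theorem orthonormal_engelVec (ξ : Fin 4 → ZpDual p) : Orthonormal ℂ (engelVec ξ) := by
  classical
  have hp : (p : ℝ) ^ engelLevel ξ ≠ 0 :=
    pow_ne_zero _ (Nat.cast_ne_zero.2 (Fact.out : p.Prime).ne_zero)
  have hp0 : (0 : ℝ) ≤ (p : ℝ) ^ engelLevel ξ := by positivity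
  rw [orthonormal_iff_ite]
  intro h h'
  rw [Submodule.coe_inner]
  change inner ℂ (engelBasis ξ h) (engelBasis ξ h') = _
  rw [engelBasis, engelBasis, L2.inner_indicatorConstLp_indicatorConstLp]
  split_ifs with hh
  · subst hh
    rw [Set.inter_self, haarZp_real_cosetZp, engelNorm_eq, RCLike.inner_apply, Complex.conj_ofReal,
      ← Complex.ofReal_mul, Real.mul_self_sqrt hp0, Complex.real_smul, ← Complex.ofReal_mul,
      inv_mul_cancel₀ hp, Complex.ofReal_one]
  · rw [disjoint_cosetZp hh, measureReal_empty, zero_smul]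

theorem span_engelVec (ξ : Fin 4 → ZpDual p) :
    ⊤ ≤ Submodule.span ℂ (Set.range (engelVec ξ)) := by
  rintro ⟨φ, hφ⟩ -
  refine Submodule.span_induction
    (p := fun φ hφ => (⟨φ, hφ⟩ : engelSpace ξ) ∈ Submodule.span ℂ (Set.range (engelVec ξ)))
    ?_ ?_ ?_ ?_ hφ
  · rintro _ ⟨h, rfl⟩
    exact Submodule.subset_span ⟨h, rfl⟩
  · exact zero_mem _
  · intro a b ha hb h1 h2
    exact add_mem h1 h2
  · intro c a ha h1
    exact Submodule.smul_mem _ c h1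

/-- The orthonormal basis `(φ_h)` of `H_ξ`. -/
def engelONB (ξ : Fin 4 → ZpDual p) :
    OrthonormalBasis (ZpMod p (engelLevel ξ)) ℂ (engelSpace ξ) :=
  OrthonormalBasis.mk (orthonormal_engelVec ξ) (span_engelVec ξ)

theorem engelONB_apply (ξ : Fin 4 → ZpDual p) (h : ZpMod p (engelLevel ξ)) :
    engelONB ξ h = engelVec ξ h := by
  rw [engelONB, OrthonormalBasis.coe_mk]

theorem finrank_engelSpace (ξ : Fin 4 → ZpDual p) :
    (Module.finrank ℂ (engelSpace ξ) : ℝ) = max ‖(ξ 2).rep‖ ‖(ξ 3).rep‖ := by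
  rw [Module.finrank_eq_card_basis (engelONB ξ).toBasis, card_ZpMod, ← engelNorm, engelNorm_eq]
  push_cast
  rfl

/-- An element of `H_ξ` is the step function given by its coordinates. -/
theorem coeFn_engelSpace (ξ : Fin 4 → ZpDual p) (φ : engelSpace ξ) :
    (φ : L2Zp p) =ᵐ[haarZp p] fun u => ((Real.sqrt (engelNorm ξ) : ℝ) : ℂ) *
      (engelONB ξ).repr φ (Ideal.Quotient.mk _ u) := by
  classical
  have key : ∀ (s : Finset (ZpMod p (engelLevel ξ))) (a : ZpMod p (engelLevel ξ) → ℂ),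
      ((∑ h ∈ s, a h • engelBasis ξ h : L2Zp p) : ℤ_[p] → ℂ) =ᵐ[haarZp p]
        fun u => ∑ h ∈ s, (cosetZp h).indicator
          (fun _ => ((Real.sqrt (engelNorm ξ) : ℝ) : ℂ) * a h) u := by
    intro s a
    induction s using Finset.induction_on with
    | empty =>
      simp only [Finset.sum_empty]
      exact Lp.coeFn_zero _ _ _
    | insert h s hs ih =>
      rw [Finset.sum_insert hs]
      filter_upwards [ih, Lp.coeFn_add (a h • engelBasis ξ h) (∑ h ∈ s, a h • engelBasis ξ h),
        Lp.coeFn_smul (a h) (engelBasis ξ h), indicatorConstLp_coeFn (p := 2)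
          (hs := measurableSet_cosetZp h) (hμs := measure_ne_top (haarZp p) _)
          (c := ((Real.sqrt (engelNorm ξ) : ℝ) : ℂ))] with u h1 h2 h3 h4
      rw [h2, Pi.add_apply, h1, h3, Pi.smul_apply, Finset.sum_insert hs, engelBasis, h4]
      congr 1
      by_cases hu : u ∈ cosetZp h
      · rw [Set.indicator_of_mem hu, Set.indicator_of_mem hu, smul_eq_mul, mul_comm]
      · rw [Set.indicator_of_notMem hu, Set.indicator_of_notMem hu, smul_zero]
  have h1 : (φ : L2Zp p) = ∑ h, (engelONB ξ).repr φ h • engelBasis ξ h := by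
    conv_lhs => rw [← (engelONB ξ).sum_repr φ]
    rw [Submodule.coe_sum]
    refine Finset.sum_congr rfl fun h _ => ?_
    rw [engelONB_apply]
    rfl
  rw [h1]
  filter_upwards [key Finset.univ fun h => (engelONB ξ).repr φ h] with u hu
  rw [hu, sum_indicator_cosetZp (fun h => ((Real.sqrt (engelNorm ξ) : ℝ) : ℂ) *
      (engelONB ξ).repr φ h)]

end Space

/-! ### The representations `π_ξ` -/

section Representation

variable {p : ℕ} [Fact p.Prime]

theorem dvd_engelLevel (ξ : Fin 4 → ZpDual p) {a : ℤ_[p]} (ha : (p : ℤ_[p]) ^ engelLevel ξ ∣ a) :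
    (ξ 2).rep * a ∈ padicIntSubgroup p ∧ (ξ 3).rep * a ∈ padicIntSubgroup p := by
  rw [ZpDual.rep_mul_mem_iff, ZpDual.rep_mul_mem_iff]
  exact ⟨(pow_dvd_pow _ (le_max_left _ _)).trans ha, (pow_dvd_pow _ (le_max_right _ _)).trans ha⟩

theorem engelLevel_dvd (ξ : Fin 4 → ZpDual p) {a : ℤ_[p]}
    (h2 : (ξ 2).rep * a ∈ padicIntSubgroup p) (h3 : (ξ 3).rep * a ∈ padicIntSubgroup p) :
    (p : ℤ_[p]) ^ engelLevel ξ ∣ a := by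
  rw [ZpDual.rep_mul_mem_iff] at h2 h3
  rcases max_choice (poleOrder (ξ 2).rep) (poleOrder (ξ 3).rep) with h | h
  · rw [engelLevel, h]
    exact h2
  · rw [engelLevel, h]
    exact h3

theorem engelPhase_eq (ξ : Fin 4 → ZpDual p) (x : EngelGroup p) (u : ℤ_[p]) :
    engelPhase ξ x u = engelDot ξ x + engelQuad ξ x u := by
  simp only [engelPhase, engelDot, engelQuad, Fin.sum_univ_four]
  ring

/-- The multiplier `e^{2πi{…}_p}` of `π_ξ(x)`, as a function on `ℤ_p / p ^ (-ϑ(ξ₃, ξ₄)) ℤ_p`. -/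
def engelMult (ξ : Fin 4 → ZpDual p) (x : EngelGroup p) (h : ZpMod p (engelLevel ξ)) : ℂ :=
  padicExp (engelPhase ξ x (Quotient.out h))

theorem norm_engelMult (ξ : Fin 4 → ZpDual p) (x : EngelGroup p) (h : ZpMod p (engelLevel ξ)) :
    ‖engelMult ξ x h‖ = 1 := norm_padicExp _

theorem continuous_engelPhase (ξ : Fin 4 → ZpDual p) (u : ℤ_[p]) :
    Continuous fun x : EngelGroup p => engelPhase ξ x u := by
  have hx : ∀ i : Fin 4, Continuous fun x : EngelGroup p => ((x i : ℤ_[p]) : ℚ_[p]) :=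
    fun i => continuous_subtype_val.comp (continuous_apply (A := fun _ : Fin 4 => ℤ_[p]) i)
  unfold engelPhase
  have := hx 0
  have := hx 1
  have := hx 2
  have := hx 3
  fun_prop

/-- A unitary representation on a space given by norm-preserving linear maps. -/
def UnitaryRep.ofLinear {G H : Type*} [Group G] [TopologicalSpace G] [NormedAddCommGroup H]
    [InnerProductSpace ℂ H] (A : G → H →ₗ[ℂ] H) (one : ∀ a, A 1 a = a)
    (mul : ∀ g g' a, A (g * g') a = A g (A g' a)) (norm : ∀ g a, ‖A g a‖ = ‖a‖)
    (cont : ∀ a, Continuous fun g => A g a) : UnitaryRep G H where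
  toHom :=
    { toFun := fun g =>
        { toLinearEquiv := LinearEquiv.ofLinearMap (A g) (A g⁻¹)
            (by ext a; simp [← mul, one]) (by ext a; simp [← mul, one])
          norm_map' := norm g }
      map_one' := by ext a; exact one a
      map_mul' := fun g g' => by ext a; exact mul g g' a }
  continuous_apply := cont

/-- The operator `π_ξ(x)` in the coordinates of the basis `(φ_h)`: the translation by `x₁`, followed
by the multiplier. -/
def engelCoordOp (ξ : Fin 4 → ZpDual p) (x : EngelGroup p) :
    EuclideanSpace ℂ (ZpMod p (engelLevel ξ)) →ₗ[ℂ] EuclideanSpace ℂ (ZpMod p (engelLevel ξ)) where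
  toFun f := WithLp.toLp 2 fun h => engelMult ξ x h * f (h + Ideal.Quotient.mk _ (x 0))
  map_add' f g := by
    ext h
    simp [mul_add]
  map_smul' c f := by
    ext h
    simp [mul_left_comm]

theorem engelCoordOp_apply (ξ : Fin 4 → ZpDual p) (x : EngelGroup p)
    (f : EuclideanSpace ℂ (ZpMod p (engelLevel ξ))) (h : ZpMod p (engelLevel ξ)) :
    engelCoordOp ξ x f h = engelMult ξ x h * f (h + Ideal.Quotient.mk _ (x 0)) := rfl

theorem norm_engelCoordOp (ξ : Fin 4 → ZpDual p) (x : EngelGroup p)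
    (f : EuclideanSpace ℂ (ZpMod p (engelLevel ξ))) : ‖engelCoordOp ξ x f‖ = ‖f‖ := by
  rw [EuclideanSpace.norm_eq, EuclideanSpace.norm_eq]
  congr 1
  rw [← Equiv.sum_comp (Equiv.addRight (Ideal.Quotient.mk _ (x 0))) fun h => ‖f h‖ ^ 2]
  refine Finset.sum_congr rfl fun h _ => ?_
  rw [engelCoordOp_apply, norm_mul, norm_engelMult, one_mul, Equiv.coe_addRight]

variable [Fact (2 < p)]

theorem coe_halfZp : ((halfZp p : ℤ_[p]) : ℚ_[p]) = 1 / 2 := rfl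

theorem padicExp_engelPhase_congr (ξ : Fin 4 → ZpDual p) (x : EngelGroup p) {u v : ℤ_[p]}
    (h : (Ideal.Quotient.mk _ u : ZpMod p (engelLevel ξ)) = Ideal.Quotient.mk _ v) :
    padicExp (engelPhase ξ x u) = padicExp (engelPhase ξ x v) := by
  obtain ⟨h2, h3⟩ := dvd_engelLevel ξ (mk_eq_mk_iff.1 h)
  rw [padicExp_eq_iff]
  have key := add_mem (mul_coe_mem h2 (x 1))
    (mul_coe_mem h3 (x 2 + halfZp p * (u + v) * x 1))
  convert key using 1
  simp only [engelPhase]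
  push_cast
  rw [coe_halfZp]
  ring

theorem engelMult_mk (ξ : Fin 4 → ZpDual p) (x : EngelGroup p) (u : ℤ_[p]) :
    engelMult ξ x (Ideal.Quotient.mk _ u) = padicExp (engelPhase ξ x u) :=
  padicExp_engelPhase_congr ξ x (Quotient.out_eq _)

namespace EngelGroup

theorem mul_zero' (x y : EngelGroup p) : (x * y) 0 = x 0 + y 0 := rfl
theorem mul_one' (x y : EngelGroup p) : (x * y) 1 = x 1 + y 1 := rfl
theorem mul_two' (x y : EngelGroup p) : (x * y) 2 = x 2 + y 2 + x 0 * y 1 := rfl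
theorem mul_three' (x y : EngelGroup p) :
    (x * y) 3 = x 3 + y 3 + x 0 * y 2 + halfZp p * x 0 ^ 2 * y 1 := rfl

theorem one_apply (i : Fin 4) : (1 : EngelGroup p) i = 0 := by
  fin_cases i <;> rfl

end EngelGroup

theorem engelPhase_one (ξ : Fin 4 → ZpDual p) (u : ℤ_[p]) : engelPhase ξ 1 u = 0 := by
  simp [engelPhase, EngelGroup.one_apply]

theorem engelPhase_mul (ξ : Fin 4 → ZpDual p) (x y : EngelGroup p) (u : ℤ_[p]) :
    engelPhase ξ (x * y) u = engelPhase ξ x u + engelPhase ξ y (u + x 0) := by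
  simp only [engelPhase, EngelGroup.mul_zero', EngelGroup.mul_one', EngelGroup.mul_two',
    EngelGroup.mul_three']
  push_cast
  rw [coe_halfZp]
  ring

theorem engelMult_mul (ξ : Fin 4 → ZpDual p) (x y : EngelGroup p) (h : ZpMod p (engelLevel ξ)) :
    engelMult ξ (x * y) h
      = engelMult ξ x h * engelMult ξ y (h + Ideal.Quotient.mk _ (x 0)) := by
  obtain ⟨u, rfl⟩ := Ideal.Quotient.mk_surjective h
  rw [← map_add, engelMult_mk, engelMult_mk, engelMult_mk, engelPhase_mul, padicExp_add]

/-- The representation `π_ξ` on `H_ξ`. -/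
def engelRep (ξ : Fin 4 → ZpDual p) : UnitaryRep (EngelGroup p) (engelSpace ξ) :=
  UnitaryRep.ofLinear
    (fun x => (engelONB ξ).repr.symm.toLinearEquiv.toLinearMap ∘ₗ engelCoordOp ξ x ∘ₗ
      (engelONB ξ).repr.toLinearEquiv.toLinearMap)
    (by
      intro a
      have : engelCoordOp ξ 1 ((engelONB ξ).repr a) = (engelONB ξ).repr a := by
        ext h
        obtain ⟨u, rfl⟩ := Ideal.Quotient.mk_surjective h
        rw [engelCoordOp_apply, engelMult_mk, engelPhase_one, padicExp_zero, EngelGroup.one_apply,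
          map_zero, add_zero, one_mul]
      simp [this])
    (by
      intro x y a
      have : engelCoordOp ξ (x * y) ((engelONB ξ).repr a)
          = engelCoordOp ξ x (engelCoordOp ξ y ((engelONB ξ).repr a)) := by
        ext h
        rw [engelCoordOp_apply, engelCoordOp_apply, engelCoordOp_apply, engelMult_mul,
          EngelGroup.mul_zero', map_add, mul_assoc, add_assoc]
      simp [this])
    (by
      intro x a
      simp [norm_engelCoordOp])
    (by
      intro a
      refine (engelONB ξ).repr.symm.continuous.comp ?_
      refine (PiLp.continuous_toLp 2 _).comp (continuous_pi fun h => ?_)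
      obtain ⟨u, rfl⟩ := Ideal.Quotient.mk_surjective h
      simp only [engelMult_mk]
      refine (continuous_padicExp.comp (continuous_engelPhase ξ u)).mul ?_
      exact (continuous_comp_mk fun k => (engelONB ξ).repr a (Ideal.Quotient.mk _ u + k)).comp
        (continuous_apply (A := fun _ : Fin 4 => ℤ_[p]) 0))

theorem repr_engelRep (ξ : Fin 4 → ZpDual p) (x : EngelGroup p) (φ : engelSpace ξ)
    (h : ZpMod p (engelLevel ξ)) :
    (engelONB ξ).repr (engelRep ξ x φ) h
      = engelMult ξ x h * (engelONB ξ).repr φ (h + Ideal.Quotient.mk _ (x 0)) := by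
  rw [← engelCoordOp_apply]
  exact congrArg (fun f : EuclideanSpace ℂ (ZpMod p (engelLevel ξ)) => f h)
    ((engelONB ξ).repr.apply_symm_apply _)

theorem coeFn_engelRep (ξ : Fin 4 → ZpDual p) (x : EngelGroup p) (φ : engelSpace ξ) :
    ((engelRep ξ x φ : engelSpace ξ) : L2Zp p) =ᵐ[haarZp p]
      fun u => padicExp (engelPhase ξ x u) * (φ : L2Zp p) (u + x 0) := by
  have h1 := coeFn_engelSpace ξ (engelRep ξ x φ)
  have h2 := (measurePreserving_add_right (haarZp p) (x 0)).quasiMeasurePreserving.ae_eq_comp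
    (coeFn_engelSpace ξ φ)
  filter_upwards [h1, h2] with u hu1 hu2
  simp only [Function.comp_apply] at hu2
  rw [hu1, hu2, repr_engelRep, engelMult_mk, map_add]
  ring

theorem inner_engelRep (ξ : Fin 4 → ZpDual p) (x : EngelGroup p) (h h' : ℤ_[p]) :
    inner ℂ (engelVec ξ (Ideal.Quotient.mk _ h'))
        (engelRep ξ x (engelVec ξ (Ideal.Quotient.mk _ h)))
      = padicExp (engelDot ξ x + engelQuad ξ x h') *
        (cosetZp (Ideal.Quotient.mk _ (h - h') : ZpMod p (engelLevel ξ))).indicator 1 (x 0) := by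
  classical
  rw [← engelONB_apply, ← engelONB_apply, ← OrthonormalBasis.repr_apply_apply, repr_engelRep,
    engelMult_mk, engelPhase_eq, OrthonormalBasis.repr_self]
  congr 1
  rw [Set.indicator_apply, mem_cosetZp, map_sub]
  simp only [PiLp.single_apply, Pi.one_apply, eq_sub_iff_add_eq, add_comm]

theorem character_engelRep (ξ : Fin 4 → ZpDual p) (x : EngelGroup p) :
    (engelRep ξ).character x
      = (engelNorm ξ : ℂ) * padicExp (engelDot ξ x) *
        (cosetZp (0 : ZpMod p (engelLevel ξ))).indicator 1 (x 0) *
        ∫ u : ℤ_[p], padicExp (engelQuad ξ x u) ∂(haarZp p) := by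
  classical
  have hp : (p : ℂ) ^ engelLevel ξ ≠ 0 :=
    pow_ne_zero _ (Nat.cast_ne_zero.2 (Fact.out : p.Prime).ne_zero)
  have hq : ∀ u : ℤ_[p], padicExp (engelDot ξ x) * padicExp (engelQuad ξ x u)
      = engelMult ξ x (Ideal.Quotient.mk _ u) := by
    intro u
    rw [engelMult_mk, engelPhase_eq, padicExp_add]
  have h1 : padicExp (engelDot ξ x) * ∫ u : ℤ_[p], padicExp (engelQuad ξ x u) ∂(haarZp p)
      = ((p : ℂ) ^ engelLevel ξ)⁻¹ * ∑ h, engelMult ξ x h := by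
    rw [← integral_const_mul, ← integral_step]
    simp only [hq]
  have h2 : (engelRep ξ).character x = ∑ h : ZpMod p (engelLevel ξ),
      engelMult ξ x h * (cosetZp (0 : ZpMod p (engelLevel ξ))).indicator 1 (x 0) := by
    rw [UnitaryRep.character, LinearMap.trace_eq_sum_inner _ (engelONB ξ)]
    refine Finset.sum_congr rfl fun h _ => ?_
    obtain ⟨u, rfl⟩ := Ideal.Quotient.mk_surjective h
    have := inner_engelRep ξ x u u
    rw [engelMult_mk, engelPhase_eq]
    rw [sub_self, map_zero] at this
    rw [← this, engelONB_apply]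
    rfl
  have h3 : ∑ h, engelMult ξ x h = (engelNorm ξ : ℂ) *
      (padicExp (engelDot ξ x) * ∫ u : ℤ_[p], padicExp (engelQuad ξ x u) ∂(haarZp p)) := by
    rw [h1, engelNorm_eq]
    push_cast
    field_simp
  rw [h2, ← Finset.sum_mul, h3]
  ring

end Representation

/-! ### Orbits of characters of the normal subgroup `x₁ = 0` -/

section Orbits

variable {p : ℕ} [Fact p.Prime]

theorem poleOrder_le_of_norm_le {l l' : ZpDual p} (h : ‖l.rep‖ ≤ ‖l'.rep‖) :
    poleOrder l.rep ≤ poleOrder l'.rep := by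
  have hp : (1 : ℝ) < p := by exact_mod_cast (Fact.out : p.Prime).one_lt
  rw [l.norm_rep, l'.norm_rep] at h
  exact (pow_le_pow_iff_right₀ hp).1 h

/-- The condition on `(ξ₂, ξ₃, ξ₄)` in the index set of the dual of the Engel group. It selects one
character from each orbit of the group on the characters of the normal subgroup `x₁ = 0`. -/
def IsOrbitRep (l₂ l₃ l₄ : ZpDual p) : Prop :=
  (‖l₄.rep‖ < ‖l₃.rep‖ ∧ l₂.rep ∈ quotReps p (poleOrder l₃.rep)) ∨ ‖l₃.rep‖ = 1

theorem mem_engelDual_iff (ξ : Fin 4 → ZpDual p) :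
    ξ ∈ engelDual p ↔
      (ξ 0).rep ∈ quotReps p (engelLevel ξ) ∧ IsOrbitRep (ξ 1) (ξ 2) (ξ 3) := by
  have h1 := (ξ 3).one_le_norm_rep
  have hA : ‖(ξ 3).rep‖ < ‖(ξ 2).rep‖ → engelLevel ξ = poleOrder (ξ 2).rep := fun h =>
    max_eq_left (poleOrder_le_of_norm_le h.le)
  have hB : ‖(ξ 2).rep‖ = 1 → engelLevel ξ = poleOrder (ξ 3).rep := fun h =>
    max_eq_right (poleOrder_le_of_norm_le (h.le.trans h1))
  have hH : ![ξ 0, ξ 1, ξ 2] ∈ heisenbergDual p ↔ (ξ 0).rep ∈ quotReps p (poleOrder (ξ 2).rep) ∧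
    (ξ 1).rep ∈ quotReps p (poleOrder (ξ 2).rep) := Iff.rfl
  simp only [engelDual, Set.mem_ofPred_eq, hH, IsOrbitRep]
  constructor
  · rintro (⟨-, h, h0, h2⟩ | ⟨h, h0⟩)
    · rw [hA h]
      exact ⟨h0, Or.inl ⟨h, h2⟩⟩
    · rw [hB h]
      exact ⟨h0, Or.inr h⟩
  · rintro ⟨h0, ⟨h, h2⟩ | h⟩
    · rw [hA h] at h0
      exact Or.inl ⟨h1, h, h0, h2⟩
    · rw [hB h] at h0
      exact Or.inr ⟨h, h0⟩

theorem isUnit_add_mul {B C : ℤ_[p]} (hB : ‖B‖ = 1) (hC : ‖C‖ < 1) (x : ℤ_[p]) :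
    IsUnit (B + x * C) := by
  rw [PadicInt.isUnit_iff]
  have h : ‖x * C‖ < ‖B‖ := by
    rw [hB, norm_mul]
    exact (mul_le_of_le_one_left (norm_nonneg _) (PadicInt.norm_le_one x)).trans_lt hC
  rw [PadicInt.norm_add_eq_max_of_ne h.ne', max_eq_left h.le, hB]

/-- If `B` is a unit and `p ∣ C`, then `a ↦ a B - a² C` is onto modulo `p ^ m`, being injective. -/
theorem exists_dvd_quadratic {B C : ℤ_[p]} (hB : ‖B‖ = 1) (hC : ‖C‖ < 1) (m : ℕ) (D : ℤ_[p]) :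
    ∃ a : ℤ_[p], (p : ℤ_[p]) ^ m ∣ a * B - a ^ 2 * C - D := by
  let f : ZpMod p m → ZpMod p m := fun h =>
    h * Ideal.Quotient.mk _ B - h ^ 2 * Ideal.Quotient.mk _ C
  have hf : Function.Injective f := by
    intro h h' hh
    obtain ⟨u, rfl⟩ := Ideal.Quotient.mk_surjective h
    obtain ⟨v, rfl⟩ := Ideal.Quotient.mk_surjective h'
    simp only [f, ← map_mul, ← map_pow, ← map_sub] at hh
    rw [mk_eq_mk_iff] at hh ⊢
    have h1 : u * B - u ^ 2 * C - (v * B - v ^ 2 * C) = (u - v) * (B + (-(u + v)) * C) := by ring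
    rwa [h1, (isUnit_add_mul hB hC _).dvd_mul_right] at hh
  obtain ⟨h, hh⟩ := Finite.surjective_of_injective hf (Ideal.Quotient.mk _ D)
  obtain ⟨a, rfl⟩ := Ideal.Quotient.mk_surjective h
  refine ⟨a, ?_⟩
  simp only [f, ← map_mul, ← map_pow, ← map_sub] at hh
  rwa [mk_eq_mk_iff] at hh

theorem norm_mul_pow_poleOrder (l : ZpDual p) : ‖l.rep * (p : ℚ_[p]) ^ poleOrder l.rep‖ = 1 := by
  have hp : (p : ℝ) ≠ 0 := Nat.cast_ne_zero.2 (Fact.out : p.Prime).ne_zero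
  rw [norm_mul, l.norm_rep, norm_pow, Padic.norm_p, inv_pow, mul_inv_cancel₀ (pow_ne_zero _ hp)]

theorem mem_of_mul_pow_eq {u : ℚ_[p]} {m : ℕ} {z : ℤ_[p]} (h : u * (p : ℚ_[p]) ^ m = z)
    (hz : (p : ℤ_[p]) ^ m ∣ z) : u ∈ padicIntSubgroup p := by
  obtain ⟨w, rfl⟩ := hz
  have : u = w := by
    apply mul_right_cancel₀ (pow_ne_zero m (natCast_prime_ne_zero (p := p)))
    rw [h]
    push_cast
    ring
  rw [this]
  exact coe_mem_padicIntSubgroup w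

theorem dvd_of_mul_pow_eq {u : ℚ_[p]} {m : ℕ} {z : ℤ_[p]} (h : u * (p : ℚ_[p]) ^ m = z)
    (hu : u ∈ padicIntSubgroup p) : (p : ℤ_[p]) ^ m ∣ z := by
  obtain ⟨w, rfl⟩ := exists_coe_eq hu
  refine ⟨w, PadicInt.ext ?_⟩
  push_cast
  rw [← h, mul_comm]

/-- Representatives have the same norm when they differ by something smaller than one of them,
modulo `ℤ_p`. -/
theorem norm_rep_eq_of_sub_mem {l l' : ZpDual p} {w : ℚ_[p]}
    (h : l'.rep - (l.rep + w) ∈ padicIntSubgroup p) (h1 : 1 < ‖l.rep‖) (hw : ‖w‖ < ‖l.rep‖) :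
    ‖l'.rep‖ = ‖l.rep‖ := by
  have h2 : ‖w + (l'.rep - (l.rep + w))‖ < ‖l.rep‖ :=
    (Padic.nonarchimedean _ _).trans_lt (max_lt hw (h.trans_lt h1))
  have h3 : l'.rep = l.rep + (w + (l'.rep - (l.rep + w))) := by ring
  rw [h3, Padic.add_eq_max_of_ne h2.ne', max_eq_left h2.le]

theorem norm_mul_coe_le (u : ℚ_[p]) (z : ℤ_[p]) : ‖u * z‖ ≤ ‖u‖ := by
  rw [norm_mul]
  exact mul_le_of_le_one_right (norm_nonneg _) z.2

variable [Fact (2 < p)]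

/-- The data of the quadratic congruence in the case `|ξ₄| < |ξ₃|`. -/
theorem exists_scaled {l₃ l₄ : ZpDual p} (h : ‖l₄.rep‖ < ‖l₃.rep‖) :
    ∃ B C : ℤ_[p], ‖B‖ = 1 ∧ ‖C‖ < 1 ∧ l₃.rep * (p : ℚ_[p]) ^ poleOrder l₃.rep = B ∧
      l₄.rep / 2 * (p : ℚ_[p]) ^ poleOrder l₃.rep = C := by
  have hB := norm_mul_pow_poleOrder l₃
  have hlt : ‖l₄.rep / 2 * (p : ℚ_[p]) ^ poleOrder l₃.rep‖ < 1 := by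
    have hpp : 0 < ‖(p : ℚ_[p]) ^ poleOrder l₃.rep‖ :=
      norm_pos_iff.2 (pow_ne_zero _ natCast_prime_ne_zero)
    have h2 : ‖l₄.rep / 2‖ ≤ ‖l₄.rep‖ := by
      have := norm_mul_coe_le l₄.rep (halfZp p)
      rwa [coe_halfZp, mul_one_div] at this
    rw [norm_mul, ← hB, norm_mul]
    exact mul_lt_mul_of_pos_right (h2.trans_lt h) hpp
  exact ⟨⟨_, hB.le⟩, ⟨_, hlt.le⟩, hB, hlt, rfl, rfl⟩

/-- Every orbit of characters of the normal subgroup `x₁ = 0` meets the chosen system. -/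
theorem exists_isOrbitRep (η : ℚ_[p]) (l₃ l₄ : ZpDual p) :
    ∃ (a : ℤ_[p]) (l₂' l₃' : ZpDual p), IsOrbitRep l₂' l₃' l₄ ∧
      (η - a * l₃.rep + a ^ 2 / 2 * l₄.rep) - l₂'.rep ∈ padicIntSubgroup p ∧
      (l₃.rep - a * l₄.rep) - l₃'.rep ∈ padicIntSubgroup p := by
  rcases lt_or_ge ‖l₄.rep‖ ‖l₃.rep‖ with h | h
  · obtain ⟨B, C, hB, hC, hBe, hCe⟩ := exists_scaled h
    set m := poleOrder l₃.rep with hm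
    obtain ⟨l₂, hl₂, hD⟩ := exists_rep_mem_quotReps m η
    obtain ⟨D, hDe⟩ := exists_coe_eq (neg_mem hD)
    obtain ⟨a, ha⟩ := exists_dvd_quadratic hB hC m D
    have hmk := ZpDual.rep_mk_sub_mem (l₃.rep - (a : ℚ_[p]) * l₄.rep)
    -- subtracting `a l₄` does not change the norm of `l₃`, hence not the modulus `p ^ m` either
    set l₃' : ZpDual p := ((l₃.rep - (a : ℚ_[p]) * l₄.rep : ℚ_[p]) : ZpDual p) with hl₃'
    have hnorm : ‖l₃'.rep‖ = ‖l₃.rep‖ := by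
      apply norm_rep_eq_of_sub_mem (w := -((a : ℚ_[p]) * l₄.rep))
      · rwa [← sub_eq_add_neg]
      · exact l₄.one_le_norm_rep.trans_lt h
      · rw [norm_neg, mul_comm]
        exact (norm_mul_coe_le _ _).trans_lt h
    refine ⟨a, l₂, l₃', Or.inl ⟨by rw [hnorm]; exact h, ?_⟩, ?_, ?_⟩
    · have : poleOrder l₃'.rep = m :=
        le_antisymm (poleOrder_le_of_norm_le hnorm.le) (poleOrder_le_of_norm_le hnorm.ge)
      rwa [this]
    · refine mem_of_mul_pow_eq (m := m) (z := -(a * B - a ^ 2 * C - D)) ?_ (ha.neg_right)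
      push_cast
      rw [hDe, ← hBe, ← hCe]
      ring
    · rw [← neg_sub]
      exact neg_mem hmk
  · -- representatives are never `0`, so the quotient makes sense even for the trivial class
    have ha : ‖l₃.rep / l₄.rep‖ ≤ 1 := by
      rw [norm_div, div_le_one (norm_pos_iff.2 l₄.rep_ne_zero)]
      exact h
    obtain ⟨a, hae⟩ := exists_coe_eq (mem_padicIntSubgroup.2 ha)
    set l₂' : ZpDual p := ((η - (a : ℚ_[p]) * l₃.rep + (a : ℚ_[p]) ^ 2 / 2 * l₄.rep : ℚ_[p]) :
      ZpDual p) with hl₂'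
    have hmk := ZpDual.rep_mk_sub_mem (η - (a : ℚ_[p]) * l₃.rep + (a : ℚ_[p]) ^ 2 / 2 * l₄.rep)
    refine ⟨a, l₂', 0, Or.inr (ZpDual.norm_rep_eq_one_iff.2 rfl), ?_, ?_⟩
    · rw [← neg_sub]
      exact neg_mem hmk
    · have h4 := l₄.rep_ne_zero
      rw [hae, div_mul_cancel₀ _ h4, sub_self, ZpDual.rep_zero, zero_sub]
      exact neg_mem (coe_mem_padicIntSubgroup (1 : ℤ_[p]))

/-- The chosen system meets every orbit of characters only once, and `b` stabilizes the character
only if it stabilizes each component. -/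
theorem IsOrbitRep.unique {l₂ l₃ l₄ l₂' l₃' l₄' : ZpDual p} (hl : IsOrbitRep l₂ l₃ l₄)
    (hl' : IsOrbitRep l₂' l₃' l₄') {b : ℤ_[p]} (h4 : l₄.rep - l₄'.rep ∈ padicIntSubgroup p)
    (h3 : l₃.rep + b * l₄.rep - l₃'.rep ∈ padicIntSubgroup p)
    (h2 : l₂.rep + b * l₃.rep + b ^ 2 / 2 * l₄.rep - l₂'.rep ∈ padicIntSubgroup p) :
    l₂ = l₂' ∧ l₃ = l₃' ∧ l₄ = l₄' ∧ l₃.rep * b ∈ padicIntSubgroup p ∧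
      l₄.rep * b ∈ padicIntSubgroup p := by
  obtain rfl := ZpDual.eq_of_rep_sub_mem h4
  -- it suffices that `b` stabilizes the characters `ξ₃` and `ξ₄`
  suffices hb : l₃.rep * b ∈ padicIntSubgroup p ∧ l₄.rep * b ∈ padicIntSubgroup p by
    obtain ⟨hb3, hb4⟩ := hb
    refine ⟨ZpDual.eq_of_rep_sub_mem ?_, ZpDual.eq_of_rep_sub_mem ?_, rfl, hb3, hb4⟩
    · convert sub_mem h2 (add_mem hb3 (mul_coe_mem hb4 (halfZp p * b))) using 1
      rw [PadicInt.coe_mul, coe_halfZp]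
      ring
    · convert sub_mem h3 hb4 using 1
      ring
  have hone := l₄.one_le_norm_rep
  have h3' : l₃'.rep - (l₃.rep + l₄.rep * b) ∈ padicIntSubgroup p := by
    rw [← neg_sub, mul_comm]
    exact neg_mem h3
  rcases hl with ⟨hlt, hq⟩ | hl
  · have hnorm : ‖l₃'.rep‖ = ‖l₃.rep‖ := norm_rep_eq_of_sub_mem h3' (hone.trans_lt hlt)
      ((norm_mul_coe_le _ _).trans_lt hlt)
    rcases hl' with ⟨hlt', hq'⟩ | hl'
    · obtain ⟨B, C, hB, hC, hBe, hCe⟩ := exists_scaled hlt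
      have hpole : poleOrder l₃'.rep = poleOrder l₃.rep :=
        le_antisymm (poleOrder_le_of_norm_le hnorm.le) (poleOrder_le_of_norm_le hnorm.ge)
      rw [hpole] at hq'
      set m := poleOrder l₃.rep with hm
      have hmul : (b * l₃.rep + b ^ 2 / 2 * l₄.rep) * (p : ℚ_[p]) ^ m
          = (b * (B + b * C) : ℤ_[p]) := by
        push_cast
        rw [← hBe, ← hCe]
        ring
      have hl₂ : l₂ = l₂' := by
        apply eq_of_rep_mem_quotReps hq hq'
        have h5 := mul_coe_mem h2 ((p : ℤ_[p]) ^ m)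
        have h6 : (b * l₃.rep + b ^ 2 / 2 * l₄.rep) * (p : ℚ_[p]) ^ m ∈ padicIntSubgroup p := by
          rw [hmul]
          exact coe_mem_padicIntSubgroup _
        convert sub_mem h5 h6 using 1
        push_cast
        ring
      subst hl₂
      have h7 : (b * l₃.rep + b ^ 2 / 2 * l₄.rep) ∈ padicIntSubgroup p := by
        convert h2 using 1
        ring
      have h8 := dvd_of_mul_pow_eq hmul h7
      rw [(isUnit_add_mul hB hC _).dvd_mul_right] at h8
      refine ⟨(l₃.rep_mul_mem_iff b).2 h8, (l₄.rep_mul_mem_iff b).2 ?_⟩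
      exact (pow_dvd_pow _ (poleOrder_le_of_norm_le hlt.le)).trans h8
    · rw [hl'] at hnorm
      exact absurd hnorm (hone.trans_lt hlt).ne
  · have hl0 := ZpDual.norm_rep_eq_one_iff.1 hl
    have h3i : l₃.rep ∈ padicIntSubgroup p := ZpDual.rep_mem_iff.2 hl0
    rcases hl' with ⟨hlt', hq'⟩ | hl'
    · exfalso
      -- `l₃'` is congruent to `b l₄`, hence not larger than `l₄`
      have h5 : l₃'.rep = l₄.rep * b + (l₃'.rep - (l₃.rep + l₄.rep * b) + l₃.rep) := by ring
      have h6 : ‖l₃'.rep - (l₃.rep + l₄.rep * b) + l₃.rep‖ ≤ 1 :=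
        mem_padicIntSubgroup.1 (add_mem h3' h3i)
      have h7 : ‖l₃'.rep‖ ≤ ‖l₄.rep‖ := by
        rw [h5]
        exact (Padic.nonarchimedean _ _).trans (max_le (norm_mul_coe_le _ _) (h6.trans hone))
      exact absurd hlt' (not_lt.2 h7)
    · have h3i' : l₃'.rep ∈ padicIntSubgroup p :=
        ZpDual.rep_mem_iff.2 (ZpDual.norm_rep_eq_one_iff.1 hl')
      refine ⟨mul_coe_mem h3i b, ?_⟩
      convert sub_mem (sub_mem h3i' h3i) h3' using 1
      ring

end Orbits

/-! ### Unitary representations with a common matrix coefficient -/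

section Cyclic

variable {G : Type*} [Group G] [TopologicalSpace G]
  {H : Type*} [NormedAddCommGroup H] [InnerProductSpace ℂ H]
  {K : Type*} [NormedAddCommGroup K] [InnerProductSpace ℂ K]

namespace UnitaryRep

theorem mul_apply (π : UnitaryRep G H) (g g' : G) (a : H) : π (g * g') a = π g (π g' a) := by
  rw [map_mul]
  rfl

theorem one_apply (π : UnitaryRep G H) (a : H) : π 1 a = a := by
  rw [map_one]
  rfl

theorem Equivalent.symm {π : UnitaryRep G H} {ρ : UnitaryRep G K} (h : π.Equivalent ρ) :
    ρ.Equivalent π := by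
  obtain ⟨T, hT⟩ := h
  exact ⟨T.symm, fun g a => by
    rw [LinearIsometryEquiv.symm_apply_eq, hT, LinearIsometryEquiv.apply_symm_apply]⟩

theorem Equivalent.trans {L : Type*} [NormedAddCommGroup L] [InnerProductSpace ℂ L]
    {π : UnitaryRep G H} {ρ : UnitaryRep G K} {σ : UnitaryRep G L} (h : π.Equivalent ρ)
    (h' : ρ.Equivalent σ) : π.Equivalent σ := by
  obtain ⟨T, hT⟩ := h
  obtain ⟨S, hS⟩ := h'
  exact ⟨T.trans S, fun g a => by simp only [LinearIsometryEquiv.trans_apply, hT, hS]⟩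

/-- The span of the orbit of a vector. -/
def orbitSpan (π : UnitaryRep G H) (v : H) : Submodule ℂ H :=
  Submodule.span ℂ (Set.range fun g => π g v)

theorem mem_orbitSpan (π : UnitaryRep G H) (v : H) : v ∈ π.orbitSpan v :=
  Submodule.subset_span ⟨1, π.one_apply v⟩

theorem apply_mem_orbitSpan (π : UnitaryRep G H) (v : H) (g : G) {a : H}
    (ha : a ∈ π.orbitSpan v) : π g a ∈ π.orbitSpan v := by
  have : π.orbitSpan v ≤ (π.orbitSpan v).comap (π g).toLinearEquiv.toLinearMap := by
    refine Submodule.span_le.2 ?_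
    rintro _ ⟨g', rfl⟩
    exact Submodule.subset_span ⟨g * g', π.mul_apply g g' v⟩
  exact this ha

theorem IsIrreducible.orbitSpan_eq_top {π : UnitaryRep G H} (hπ : π.IsIrreducible) {v : H}
    (hv : v ≠ 0) [FiniteDimensional ℂ (π.orbitSpan v)] : π.orbitSpan v = ⊤ := by
  refine (hπ.2 _ (Submodule.closed_of_finiteDimensional _)
    fun g a ha => π.apply_mem_orbitSpan v g ha).resolve_left fun h => hv ?_
  have := π.mem_orbitSpan v
  rwa [h, Submodule.mem_bot] at this

/-- Representations generated by vectors with the same matrix coefficient are equivalent. -/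
theorem equivalent_of_inner_eq {π : UnitaryRep G H} {ρ : UnitaryRep G K} {v : H} {w : K}
    (hv : π.orbitSpan v = ⊤) (hw : ρ.orbitSpan w = ⊤)
    (h : ∀ g, inner ℂ v (π g v) = inner ℂ w (ρ g w)) : π.Equivalent ρ := by
  let A : (G →₀ ℂ) →ₗ[ℂ] H := Finsupp.linearCombination ℂ fun g => π g v
  let B : (G →₀ ℂ) →ₗ[ℂ] K := Finsupp.linearCombination ℂ fun g => ρ g w
  have hA : Function.Surjective A := by
    rw [← LinearMap.range_eq_top, Finsupp.range_linearCombination]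
    exact hv
  have hB : Function.Surjective B := by
    rw [← LinearMap.range_eq_top, Finsupp.range_linearCombination]
    exact hw
  have hgen : ∀ g g', inner ℂ (π g v) (π g' v) = inner ℂ (ρ g w) (ρ g' w) := by
    intro g g'
    have h1 : π g' v = π g (π (g⁻¹ * g') v) := by rw [← π.mul_apply, mul_inv_cancel_left]
    have h2 : ρ g' w = ρ g (ρ (g⁻¹ * g') w) := by rw [← ρ.mul_apply, mul_inv_cancel_left]
    rw [h1, h2, LinearIsometryEquiv.inner_map_map, LinearIsometryEquiv.inner_map_map, h]
  have hinner : ∀ f f', inner ℂ (A f) (A f') = inner ℂ (B f) (B f') := by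
    intro f f'
    simp only [A, B, Finsupp.linearCombination_apply, Finsupp.sum, sum_inner, inner_sum,
      inner_smul_left, inner_smul_right, hgen]
  have hnorm : ∀ f, ‖A f‖ = ‖B f‖ := by
    intro f
    rw [@norm_eq_sqrt_re_inner ℂ, @norm_eq_sqrt_re_inner ℂ, hinner]
  have hker : LinearMap.ker A = LinearMap.ker B := by
    ext f
    rw [LinearMap.mem_ker, LinearMap.mem_ker, ← norm_eq_zero, hnorm, norm_eq_zero]
  let e : H ≃ₗ[ℂ] K := (A.quotKerEquivOfSurjective hA).symm ≪≫ₗ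
    Submodule.quotEquivOfEq _ _ hker ≪≫ₗ B.quotKerEquivOfSurjective hB
  have he : ∀ f, e (A f) = B f := by
    intro f
    have : (A.quotKerEquivOfSurjective hA).symm (A f) = Submodule.Quotient.mk f := by
      rw [LinearEquiv.symm_apply_eq]
      rfl
    simp only [e, LinearEquiv.trans_apply, this]
    rfl
  have hAg : ∀ g f, π g (A f) = A (Finsupp.mapDomain (fun g' => g * g') f) := by
    intro g f
    simp only [A, Finsupp.linearCombination_mapDomain]
    simp only [Finsupp.linearCombination_apply, Finsupp.sum, map_sum, map_smul, Function.comp_apply,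
      π.mul_apply]
  have hBg : ∀ g f, ρ g (B f) = B (Finsupp.mapDomain (fun g' => g * g') f) := by
    intro g f
    simp only [B, Finsupp.linearCombination_mapDomain]
    simp only [Finsupp.linearCombination_apply, Finsupp.sum, map_sum, map_smul, Function.comp_apply,
      ρ.mul_apply]
  refine ⟨⟨e, fun a => ?_⟩, fun g a => ?_⟩
  · obtain ⟨f, rfl⟩ := hA a
    rw [he, hnorm]
  · obtain ⟨f, rfl⟩ := hA a
    change e (π g (A f)) = ρ g (e (A f))
    rw [hAg, he, he, hBg]

end UnitaryRep

end Cyclic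

/-! ### Vectors fixed by a congruence subgroup -/

section Fixed

variable {p : ℕ} [Fact p.Prime]

namespace EngelGroup

/-- Reduction of the coordinates modulo `p ^ n`. -/
def red (n : ℕ) (x : EngelGroup p) (i : Fin 4) : ZpMod p n := Ideal.Quotient.mk _ (x i)

theorem red_mul_congr [Fact (2 < p)] {n : ℕ} {x x' y y' : EngelGroup p} (hx : red n x = red n x')
    (hy : red n y = red n y') : red n (x * y) = red n (x' * y') := by
  have hx' : ∀ i, (Ideal.Quotient.mk _ (x i) : ZpMod p n) = Ideal.Quotient.mk _ (x' i) :=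
    fun i => congrFun hx i
  have hy' : ∀ i, (Ideal.Quotient.mk _ (y i) : ZpMod p n) = Ideal.Quotient.mk _ (y' i) :=
    fun i => congrFun hy i
  funext i
  fin_cases i
  · change (Ideal.Quotient.mk _ (x 0 + y 0) : ZpMod p n) = Ideal.Quotient.mk _ (x' 0 + y' 0)
    simp only [map_add, hx', hy']
  · change (Ideal.Quotient.mk _ (x 1 + y 1) : ZpMod p n) = Ideal.Quotient.mk _ (x' 1 + y' 1)
    simp only [map_add, hx', hy']
  · change (Ideal.Quotient.mk _ (x 2 + y 2 + x 0 * y 1) : ZpMod p n)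
      = Ideal.Quotient.mk _ (x' 2 + y' 2 + x' 0 * y' 1)
    simp only [map_add, map_mul, hx', hy']
  · change (Ideal.Quotient.mk _ (x 3 + y 3 + x 0 * y 2 + halfZp p * x 0 ^ 2 * y 1) : ZpMod p n)
      = Ideal.Quotient.mk _ (x' 3 + y' 3 + x' 0 * y' 2 + halfZp p * x' 0 ^ 2 * y' 1)
    simp only [map_add, map_mul, map_pow, hx', hy']

end EngelGroup

variable [Fact (2 < p)] {H : Type*} [NormedAddCommGroup H] [InnerProductSpace ℂ H]

open EngelGroup

theorem exists_red_near (ρ : UnitaryRep (EngelGroup p) H) (v : H) {ε : ℝ} (hε : 0 < ε) :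
    ∃ n : ℕ, ∀ x : EngelGroup p, red n x = red n 1 → ‖ρ x v - v‖ < ε := by
  have hcont : Continuous fun x : Fin 4 → ℤ_[p] => ‖ρ.toHom (x : EngelGroup p) v - v‖ :=
    ((ρ.continuous_apply v).sub continuous_const).norm
  have hopen := hcont.isOpen_preimage _ (isOpen_Iio (a := ε))
  obtain ⟨δ, hδ, hball⟩ := Metric.isOpen_iff.1 hopen (1 : EngelGroup p) (by
    change ‖ρ 1 v - v‖ < ε
    rwa [ρ.one_apply, sub_self, norm_zero])
  have hp : ((p : ℝ)⁻¹) < 1 :=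
    inv_lt_one_of_one_lt₀ (by exact_mod_cast (Fact.out : p.Prime).one_lt)
  obtain ⟨n, hn⟩ := exists_pow_lt_of_lt_one hδ hp
  refine ⟨n, fun x hx => hball ?_⟩
  change dist (α := Fin 4 → ℤ_[p]) x (1 : EngelGroup p) < δ
  refine lt_of_le_of_lt ((dist_pi_le_iff (by positivity)).2 fun i => ?_) hn
  have h1 : (Ideal.Quotient.mk _ (x i) : ZpMod p n)
    = Ideal.Quotient.mk _ ((1 : EngelGroup p) i) := congrFun hx i
  rw [Ideal.Quotient.eq, ← PadicInt.norm_le_pow_iff_mem_span_pow, zpow_neg, zpow_natCast,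
    ← inv_pow] at h1
  exact h1

/-- In a complete convex set, the vector of least norm is fixed by every self-map of the set that
preserves its norm. -/
theorem exists_fixed_of_complete_convex {E : Type*} [NormedAddCommGroup E] [InnerProductSpace ℝ E]
    {K : Set E} (hK : K.Nonempty) (hKc : IsComplete K) (hKconv : Convex ℝ K) :
    ∃ w ∈ K, ∀ L : E → E, L w ∈ K → ‖L w‖ = ‖w‖ → L w = w := by
  obtain ⟨w, hwK, hw⟩ := exists_norm_eq_iInf_of_complete_convex hK hKc hKconv (0 : E)
  refine ⟨w, hwK, fun L hL hLw => ?_⟩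
  have hw' : ‖0 - L w‖ = ⨅ a : K, ‖0 - (a : E)‖ := by
    rw [← hw, zero_sub, zero_sub, norm_neg, norm_neg, hLw]
  have h1 := (norm_eq_iInf_iff_real_inner_le_zero hKconv hwK).1 hw _ hL
  have h2 := (norm_eq_iInf_iff_real_inner_le_zero hKconv hL).1 hw' _ hwK
  have h3 : inner ℝ (L w - w) (L w - w) ≤ 0 := by
    have e1 : inner ℝ (L w - w) (L w - w)
        = inner ℝ (0 - w) (L w - w) + inner ℝ (0 - L w) (w - L w) := by
      simp only [inner_sub_left, inner_sub_right, inner_zero_left]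
      ring
    rw [e1]
    linarith
  exact sub_eq_zero.1 (real_inner_self_nonpos.1 h3)

/-- A non-zero closed invariant subspace contains a non-zero vector that is fixed by a congruence
subgroup: the vector of least norm in the closed convex hull of the orbit, under a small congruence
subgroup, of any non-zero vector. -/
theorem exists_fixed_vector [CompleteSpace H] (ρ : UnitaryRep (EngelGroup p) H)
    (W : Submodule ℂ H) (hWc : IsClosed (W : Set H)) (hW : ∀ g, ∀ a ∈ W, ρ g a ∈ W) (hW0 : W ≠ ⊥) :
    ∃ n : ℕ, ∃ w ∈ W, w ≠ 0 ∧ ∀ x : EngelGroup p, red n x = red n 1 → ρ x w = w := by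
  let : InnerProductSpace ℝ H := InnerProductSpace.complexToReal
  obtain ⟨v, hv, hv0⟩ := W.ne_bot_iff.1 hW0
  have hvpos : 0 < ‖v‖ / 2 := by positivity
  obtain ⟨n, hn⟩ := exists_red_near ρ v hvpos
  set S : Set H := {a | ∃ x : EngelGroup p, red n x = red n 1 ∧ ρ x v = a} with hS
  set K : Set H := closedConvexHull ℝ S with hK
  have hKconv : Convex ℝ K := convex_closedConvexHull
  have hvK : v ∈ K := subset_closedConvexHull ⟨1, rfl, ρ.one_apply v⟩
  have hKW : K ⊆ W := by
    refine closedConvexHull_min ?_ (W.restrictScalars ℝ).convex hWc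
    rintro _ ⟨x, -, rfl⟩
    exact hW x v hv
  have hKball : K ⊆ Metric.closedBall v (‖v‖ / 2) := by
    refine closedConvexHull_min ?_ (convex_closedBall _ _) Metric.isClosed_closedBall
    rintro _ ⟨x, hx, rfl⟩
    rw [Metric.mem_closedBall, dist_eq_norm]
    exact (hn x hx).le
  have hKinv : ∀ x : EngelGroup p, red n x = red n 1 → ∀ a ∈ K, ρ x a ∈ K := by
    intro x hx
    have : K ⊆ (fun a => ρ x a) ⁻¹' K := by
      refine closedConvexHull_min ?_ ?_ (isClosed_closedConvexHull.preimage (ρ x).continuous)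
      · rintro _ ⟨y, hy, rfl⟩
        refine subset_closedConvexHull ⟨x * y, ?_, ρ.mul_apply x y v⟩
        rw [red_mul_congr hx hy, one_mul]
      · exact hKconv.is_linear_preimage (f := fun a => ρ x a)
          ⟨fun a b => map_add _ a b, fun c a => by
            have := (ρ x).map_smul (c : ℂ) a
            simpa using this⟩
    exact this
  obtain ⟨w, hwK, hw⟩ := exists_fixed_of_complete_convex ⟨v, hvK⟩
    isClosed_closedConvexHull.isComplete hKconv
  refine ⟨n, w, hKW hwK, ?_, fun x hx => hw (ρ x) (hKinv x hx w hwK) ((ρ x).norm_map w)⟩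
  rintro rfl
  have := hKball hwK
  rw [Metric.mem_closedBall, dist_eq_norm, zero_sub, norm_neg] at this
  linarith

/-- The orbit of a vector fixed by a congruence subgroup spans a finite-dimensional space on which
this subgroup acts trivially. -/
theorem orbitSpan_of_fixed (ρ : UnitaryRep (EngelGroup p) H) {n : ℕ} {w : H}
    (hw : ∀ x : EngelGroup p, red n x = red n 1 → ρ x w = w) :
    FiniteDimensional ℂ (ρ.orbitSpan w) ∧
      ∀ x : EngelGroup p, red n x = red n 1 → ∀ a ∈ ρ.orbitSpan w, ρ x a = a := by
  constructor
  · have hfac : ∀ x y : EngelGroup p, red n x = red n y → ρ x w = ρ y w := by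
      intro x y hxy
      have h1 : red n (y⁻¹ * x) = red n 1 := by
        rw [red_mul_congr (rfl : red n y⁻¹ = _) hxy, inv_mul_cancel]
      rw [← mul_inv_cancel_left y x, ρ.mul_apply, hw _ h1]
    refine FiniteDimensional.span_of_finite ℂ
      ((Set.finite_range (Function.extend (red n) (fun x => ρ x w) 0)).subset ?_)
    rintro _ ⟨x, rfl⟩
    refine ⟨red n x, ?_⟩
    exact Function.FactorsThrough.extend_apply (fun x y h => hfac x y h) _ x
  · intro x hx a ha
    refine Submodule.span_induction (p := fun a _ => ρ x a = a) ?_ ?_ ?_ ?_ ha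
    · rintro _ ⟨g, rfl⟩
      have h1 : red n (g⁻¹ * x * g) = red n 1 := by
        rw [red_mul_congr (red_mul_congr (rfl : red n g⁻¹ = _) hx) (rfl : red n g = _), mul_one,
          inv_mul_cancel]
      change ρ x (ρ g w) = ρ g w
      have h2 : x * g = g * (g⁻¹ * x * g) := by group
      rw [← ρ.mul_apply, h2, ρ.mul_apply, hw _ h1]
    · exact map_zero _
    · intro a b _ _ ha hb
      rw [map_add, ha, hb]
    · intro c a _ ha
      rw [map_smul, ha]

end Fixed

/-! ### Eigenvectors for actions of `ℤ_p` -/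

section Eigen

variable {p : ℕ} [Fact p.Prime] {H : Type*} [AddCommGroup H] [Module ℂ H]

/-- The eigenspace of an action of `ℤ_p` for the character `a ↦ e^{2πi{ηa}_p}`. -/
def charSpace (A : ℤ_[p] → H →ₗ[ℂ] H) (η : ℚ_[p]) : Submodule ℂ H where
  carrier := {v | ∀ a : ℤ_[p], A a v = padicExp (η * (a : ℚ_[p])) • v}
  add_mem' := by
    intro v w hv hw a
    rw [map_add, hv a, hw a, smul_add]
  zero_mem' := by
    intro a
    rw [map_zero, smul_zero]
  smul_mem' := by
    intro c v hv a
    rw [map_smul, hv a, smul_comm]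

theorem mem_charSpace {A : ℤ_[p] → H →ₗ[ℂ] H} {η : ℚ_[p]} {v : H} :
    v ∈ charSpace A η ↔ ∀ a : ℤ_[p], A a v = padicExp (η * (a : ℚ_[p])) • v := Iff.rfl

theorem map_mem_charSpace {A : ℤ_[p] → H →ₗ[ℂ] H} {η : ℚ_[p]} {v : H} (B : H →ₗ[ℂ] H)
    (hAB : ∀ a v, A a (B v) = B (A a v)) (hv : v ∈ charSpace A η) : B v ∈ charSpace A η := by
  refine mem_charSpace.2 fun a => ?_
  rw [hAB, mem_charSpace.1 hv a, map_smul]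

/-- An action of `ℤ_p` on a non-zero finite-dimensional space that is trivial on some `p ^ n ℤ_p`
has an eigenvector. -/
theorem exists_charSpace_ne_bot (A : ℤ_[p] → H →ₗ[ℂ] H)
    (hadd : ∀ a b v, A (a + b) v = A a (A b v)) (W : Submodule ℂ H) [FiniteDimensional ℂ W]
    (hW0 : W ≠ ⊥) (hW : ∀ a, ∀ v ∈ W, A a v ∈ W) (n : ℕ)
    (hker : ∀ a, ∀ v ∈ W, A ((p : ℤ_[p]) ^ n * a) v = v) :
    ∃ η : ℚ_[p], W ⊓ charSpace A η ≠ ⊥ := by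
  have : Nontrivial W := Submodule.nontrivial_iff_ne_bot.2 hW0
  obtain ⟨μ, hμ⟩ := Module.End.exists_eigenvalue ((A 1).restrict (hW 1))
  obtain ⟨⟨v, hv⟩, hvμ, hv0⟩ := hμ.exists_hasEigenvector
  have hv0' : v ≠ 0 := fun h => hv0 (Subtype.ext h)
  have h1 : A 1 v = μ • v := congrArg Subtype.val (Module.End.mem_eigenspace_iff.1 hvμ)
  have hnat : ∀ k : ℕ, A k v = μ ^ k • v := by
    intro k
    induction k with
    | zero => simpa using hker 0 v hv
    | succ k ih => rw [Nat.cast_succ, hadd, h1, map_smul, ih, smul_smul, pow_succ']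
  have hpow : μ ^ p ^ n = 1 := by
    have h2 := hnat (p ^ n)
    have h3 := hker 1 v hv
    rw [mul_one, ← Nat.cast_pow, h2] at h3
    have h4 : (μ ^ p ^ n - 1) • v = 0 := by rw [sub_smul, h3, one_smul, sub_self]
    exact sub_eq_zero.1 ((smul_eq_zero.1 h4).resolve_right hv0')
  obtain ⟨η, hη, rfl⟩ := exists_padicExp_of_pow_eq_one hpow
  refine ⟨η, (Submodule.ne_bot_iff _).2 ⟨v, ⟨hv, mem_charSpace.2 fun a => ?_⟩, hv0'⟩⟩
  obtain ⟨k, b, rfl⟩ : ∃ (k : ℕ) (b : ℤ_[p]), a = k + (p : ℤ_[p]) ^ n * b := by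
    obtain ⟨b, hb⟩ := Ideal.mem_span_singleton.1 (PadicInt.appr_spec n a)
    exact ⟨a.appr n, b, by rw [← hb]; ring⟩
  rw [hadd, hker b v hv, hnat, ← padicExp_nsmul]
  congr 1
  apply padicExp_congr
  convert neg_mem (mul_coe_mem hη b) using 1
  push_cast
  ring

end Eigen

/-! ### Weight vectors -/

section Weights

variable {p : ℕ} [Fact p.Prime]

namespace EngelGroup

/-- The element `(a, 0, 0, 0)`. -/
def shift (a : ℤ_[p]) : EngelGroup p := ![a, 0, 0, 0]

/-- The element `(0, b, c, d)` of the abelian normal subgroup `x₁ = 0`. -/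
def normal (b c d : ℤ_[p]) : EngelGroup p := ![0, b, c, d]

variable [Fact (2 < p)]

theorem normal_mul_normal (b c d b' c' d' : ℤ_[p]) :
    normal b c d * normal b' c' d' = normal (b + b') (c + c') (d + d') := by
  funext i
  fin_cases i
  · change (0 : ℤ_[p]) + 0 = 0
    ring
  · rfl
  · change c + c' + 0 * b' = c + c'
    ring
  · change d + d' + 0 * c' + halfZp p * 0 ^ 2 * b' = d + d'
    ring

theorem shift_mul_shift (a a' : ℤ_[p]) : shift a * shift a' = shift (a + a') := by
  funext i
  fin_cases i
  · rfl
  · change (0 : ℤ_[p]) + 0 = 0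
    ring
  · change (0 : ℤ_[p]) + 0 + a * 0 = 0
    ring
  · change (0 : ℤ_[p]) + 0 + a * 0 + halfZp p * a ^ 2 * 0 = 0
    ring

theorem normal_mul_shift (a b c d : ℤ_[p]) :
    normal b c d * shift a
      = shift a * normal b (c - a * b) (d - a * c + halfZp p * a ^ 2 * b) := by
  have h := halfZp_mul_two p
  funext i
  fin_cases i
  · change (0 : ℤ_[p]) + a = a + 0
    ring
  · change b + 0 = 0 + b
    ring
  · change c + 0 + 0 * 0 = 0 + (c - a * b) + a * b
    ring
  · change d + 0 + 0 * 0 + halfZp p * 0 ^ 2 * 0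
      = 0 + (d - a * c + halfZp p * a ^ 2 * b) + a * (c - a * b) + halfZp p * a ^ 2 * b
    linear_combination (-(a ^ 2 * b)) * h

theorem eq_normal_mul_shift (x : EngelGroup p) : x = normal (x 1) (x 2) (x 3) * shift (x 0) := by
  funext i
  fin_cases i
  · change x 0 = 0 + x 0
    ring
  · change x 1 = x 1 + 0
    ring
  · change x 2 = x 2 + 0 + 0 * 0
    ring
  · change x 3 = x 3 + 0 + 0 * 0 + halfZp p * 0 ^ 2 * 0
    ring

end EngelGroup

open EngelGroup

theorem engelDot_normal (ξ : Fin 4 → ZpDual p) (b c d : ℤ_[p]) :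
    engelDot ξ (normal b c d) = (ξ 1).rep * b + (ξ 2).rep * c + (ξ 3).rep * d := by
  rw [engelDot, Fin.sum_univ_four]
  change (ξ 0).rep * ((0 : ℤ_[p]) : ℚ_[p]) + (ξ 1).rep * b + (ξ 2).rep * c + (ξ 3).rep * d = _
  rw [PadicInt.coe_zero, mul_zero, zero_add]

theorem engelDot_shift (ξ : Fin 4 → ZpDual p) (a : ℤ_[p]) :
    engelDot ξ (shift a) = (ξ 0).rep * a := by
  rw [engelDot, Fin.sum_univ_four]
  change (ξ 0).rep * a + (ξ 1).rep * ((0 : ℤ_[p]) : ℚ_[p]) + (ξ 2).rep * ((0 : ℤ_[p]) : ℚ_[p])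
    + (ξ 3).rep * ((0 : ℤ_[p]) : ℚ_[p]) = _
  simp only [PadicInt.coe_zero, mul_zero, add_zero]

theorem engelDot_eq (ξ : Fin 4 → ZpDual p) (x : EngelGroup p) :
    engelDot ξ x = engelDot ξ (normal (x 1) (x 2) (x 3)) + engelDot ξ (shift (x 0)) := by
  rw [engelDot_normal, engelDot_shift, engelDot, Fin.sum_univ_four]
  ring

variable [Fact (2 < p)] {H : Type*} [NormedAddCommGroup H] [InnerProductSpace ℂ H]

/-- `v` is a weight vector: the subgroup `x₁ = 0` acts on it through the character
`(x₂, x₃, x₄) ↦ e^{2πi{η₂ x₂ + η₃ x₃ + η₄ x₄}_p}`. -/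
def IsWeight (ρ : UnitaryRep (EngelGroup p) H) (η₂ η₃ η₄ : ℚ_[p]) (v : H) : Prop :=
  ∀ b c d : ℤ_[p], ρ (normal b c d) v =
    padicExp (η₂ * (b : ℚ_[p]) + η₃ * (c : ℚ_[p]) + η₄ * (d : ℚ_[p])) • v

theorem IsWeight.congr {ρ : UnitaryRep (EngelGroup p) H} {η₂ η₃ η₄ η₂' η₃' η₄' : ℚ_[p]} {v : H}
    (h : IsWeight ρ η₂ η₃ η₄ v) (h2 : η₂ - η₂' ∈ padicIntSubgroup p)
    (h3 : η₃ - η₃' ∈ padicIntSubgroup p) (h4 : η₄ - η₄' ∈ padicIntSubgroup p) :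
    IsWeight ρ η₂' η₃' η₄' v := by
  intro b c d
  rw [h b c d]
  congr 1
  apply padicExp_congr
  convert add_mem (add_mem (mul_coe_mem h2 b) (mul_coe_mem h3 c)) (mul_coe_mem h4 d) using 1
  ring

theorem IsWeight.shift {ρ : UnitaryRep (EngelGroup p) H} {η₂ η₃ η₄ : ℚ_[p]} {v : H}
    (h : IsWeight ρ η₂ η₃ η₄ v) (a : ℤ_[p]) :
    IsWeight ρ (η₂ - a * η₃ + a ^ 2 / 2 * η₄) (η₃ - a * η₄) η₄ (ρ (EngelGroup.shift a) v) := by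
  intro b c d
  rw [← ρ.mul_apply, normal_mul_shift, ρ.mul_apply, h, map_smul]
  congr 2
  push_cast
  rw [coe_halfZp]
  ring

theorem IsWeight.inner_eq_zero {ρ : UnitaryRep (EngelGroup p) H} {η₂ η₃ η₄ η₂' η₃' η₄' : ℚ_[p]}
    {v v' : H} (h : IsWeight ρ η₂ η₃ η₄ v) (h' : IsWeight ρ η₂' η₃' η₄' v')
    (hne : ¬ (η₂ - η₂' ∈ padicIntSubgroup p ∧ η₃ - η₃' ∈ padicIntSubgroup p ∧
      η₄ - η₄' ∈ padicIntSubgroup p)) : inner ℂ v v' = 0 := by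
  by_contra hin
  have key : ∀ b c d : ℤ_[p], padicExp (η₂ * (b : ℚ_[p]) + η₃ * (c : ℚ_[p]) + η₄ * (d : ℚ_[p]))
      = padicExp (η₂' * (b : ℚ_[p]) + η₃' * (c : ℚ_[p]) + η₄' * (d : ℚ_[p])) := by
    intro b c d
    have h1 := LinearIsometryEquiv.inner_map_map (ρ (normal b c d)) v v'
    rw [h b c d, h' b c d, inner_smul_left, inner_smul_right, ← mul_assoc] at h1
    have h2 := mul_right_cancel₀ hin (h1.trans (one_mul _).symm)
    have h3 := Complex.mul_conj (padicExp (η₂ * (b : ℚ_[p]) + η₃ * (c : ℚ_[p]) + η₄ * (d : ℚ_[p])))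
    rw [Complex.normSq_eq_norm_sq, norm_padicExp, one_pow, Complex.ofReal_one] at h3
    calc padicExp (η₂ * (b : ℚ_[p]) + η₃ * (c : ℚ_[p]) + η₄ * (d : ℚ_[p]))
        = padicExp (η₂ * (b : ℚ_[p]) + η₃ * (c : ℚ_[p]) + η₄ * (d : ℚ_[p])) *
          ((starRingEnd ℂ) (padicExp (η₂ * (b : ℚ_[p]) + η₃ * (c : ℚ_[p]) + η₄ * (d : ℚ_[p]))) *
            padicExp (η₂' * (b : ℚ_[p]) + η₃' * (c : ℚ_[p]) +
              η₄' * (d : ℚ_[p]))) := by rw [h2, mul_one]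
      _ = _ := by rw [← mul_assoc, h3, one_mul]
  refine hne ⟨?_, ?_, ?_⟩ <;> apply sub_mem_of_forall_padicExp_eq <;> intro z
  · simpa using key z 0 0
  · simpa using key 0 z 0
  · simpa using key 0 0 z

/-- `w` transforms under the subgroup of all `x` with `x₁ ∈ p ^ (-ϑ(ξ₃, ξ₄)) ℤ_p` through the
character `x ↦ e^{2πi{ξ·x}_p}`. This is the property that characterizes `φ_0` in `H_ξ`. -/
def IsEngelVector (ρ : UnitaryRep (EngelGroup p) H) (ξ : Fin 4 → ZpDual p) (w : H) : Prop :=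
  ∀ x : EngelGroup p, (p : ℤ_[p]) ^ engelLevel ξ ∣ x 0 → ρ x w = padicExp (engelDot ξ x) • w

theorem IsEngelVector.isWeight {ρ : UnitaryRep (EngelGroup p) H} {ξ : Fin 4 → ZpDual p} {w : H}
    (h : IsEngelVector ρ ξ w) : IsWeight ρ (ξ 1).rep (ξ 2).rep (ξ 3).rep w := by
  intro b c d
  rw [← engelDot_normal]
  exact h _ (dvd_zero _)

theorem isEngelVector_of_isWeight {ρ : UnitaryRep (EngelGroup p) H} {ξ : Fin 4 → ZpDual p} {w : H}
    (h : IsWeight ρ (ξ 1).rep (ξ 2).rep (ξ 3).rep w)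
    (h' : ∀ a : ℤ_[p], ρ (shift ((p : ℤ_[p]) ^ engelLevel ξ * a)) w
      = padicExp ((ξ 0).rep * (((p : ℤ_[p]) ^ engelLevel ξ * a : ℤ_[p]) : ℚ_[p])) • w) :
    IsEngelVector ρ ξ w := by
  rintro x ⟨a, ha⟩
  conv_lhs => rw [eq_normal_mul_shift x]
  rw [ρ.mul_apply, ha, h', map_smul, h, smul_smul, ← padicExp_add, engelDot_eq ξ x,
    engelDot_normal, engelDot_shift, ha, add_comm ((ξ 0).rep * _)]

/-- The matrix coefficient of an Engel vector vanishes off the subgroup on which the vector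
transforms by a character, because `x` moves its weight to a different one. -/
theorem IsEngelVector.inner_eq_zero {ρ : UnitaryRep (EngelGroup p) H} {ξ : Fin 4 → ZpDual p} {w : H}
    (h : IsEngelVector ρ ξ w) {x : EngelGroup p} (hx : ¬ (p : ℤ_[p]) ^ engelLevel ξ ∣ x 0) :
    inner ℂ w (ρ x w) = 0 := by
  have hw := h.isWeight
  have hs := hw.shift (x 0)
  conv_lhs => rw [eq_normal_mul_shift x]
  rw [ρ.mul_apply, hs, inner_smul_right, hw.inner_eq_zero hs, mul_zero]
  rintro ⟨h2, h3, -⟩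
  have h3' : (ξ 3).rep * (x 0 : ℚ_[p]) ∈ padicIntSubgroup p := by
    convert h3 using 1
    ring
  refine hx (engelLevel_dvd ξ ?_ h3')
  convert add_mem h2 (mul_coe_mem h3' (halfZp p * x 0)) using 1
  rw [PadicInt.coe_mul, coe_halfZp]
  ring

theorem IsEngelVector.inner_eq {ρ : UnitaryRep (EngelGroup p) H} {ξ : Fin 4 → ZpDual p} {w : H}
    (h : IsEngelVector ρ ξ w) (hw : ‖w‖ = 1) (x : EngelGroup p) :
    inner ℂ w (ρ x w)
      = (cosetZp (0 : ZpMod p (engelLevel ξ))).indicator (fun _ => padicExp (engelDot ξ x))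
        (x 0) := by
  by_cases hx : (p : ℤ_[p]) ^ engelLevel ξ ∣ x 0
  · rw [Set.indicator_of_mem (mem_cosetZp.2 (mk_eq_zero_iff.2 hx)), h x hx, inner_smul_right,
      inner_self_eq_norm_sq_to_K, hw]
    simp
  · rw [Set.indicator_of_notMem (fun hx' => hx (mk_eq_zero_iff.1 (mem_cosetZp.1 hx'))),
      h.inner_eq_zero hx]

theorem IsEngelVector.smul {ρ : UnitaryRep (EngelGroup p) H} {ξ : Fin 4 → ZpDual p} {w : H}
    (h : IsEngelVector ρ ξ w) (c : ℂ) : IsEngelVector ρ ξ (c • w) := by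
  intro x hx
  rw [map_smul, h x hx, smul_comm]

/-- Two irreducible representations, on finite-dimensional spaces, with an Engel vector for the same
`ξ` are equivalent. -/
theorem UnitaryRep.IsIrreducible.equivalent_of_isEngelVector
    {K : Type*} [NormedAddCommGroup K] [InnerProductSpace ℂ K]
    [FiniteDimensional ℂ H] [FiniteDimensional ℂ K]
    {π : UnitaryRep (EngelGroup p) H} {ρ : UnitaryRep (EngelGroup p) K} (hπ : π.IsIrreducible)
    (hρ : ρ.IsIrreducible) {ξ : Fin 4 → ZpDual p} {v : H} {w : K} (hv : IsEngelVector π ξ v)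
    (hw : IsEngelVector ρ ξ w) (hv0 : v ≠ 0) (hw0 : w ≠ 0) : π.Equivalent ρ := by
  have h1 : ‖((‖v‖ : ℂ)⁻¹) • v‖ = 1 := norm_smul_inv_norm hv0
  have h2 : ‖((‖w‖ : ℂ)⁻¹) • w‖ = 1 := norm_smul_inv_norm hw0
  refine UnitaryRep.equivalent_of_inner_eq
    (hπ.orbitSpan_eq_top (norm_ne_zero_iff.1 (h1.trans_ne one_ne_zero)))
    (hρ.orbitSpan_eq_top (norm_ne_zero_iff.1 (h2.trans_ne one_ne_zero))) fun x => ?_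
  rw [(hv.smul _).inner_eq h1, (hw.smul _).inner_eq h2]

theorem IsEngelVector.map {K : Type*} [NormedAddCommGroup K] [InnerProductSpace ℂ K]
    {π : UnitaryRep (EngelGroup p) H} {ρ : UnitaryRep (EngelGroup p) K} {ξ : Fin 4 → ZpDual p}
    {v : H} (hv : IsEngelVector π ξ v) {T : H ≃ₗᵢ[ℂ] K} (hT : ∀ g a, T (π g a) = ρ g (T a)) :
    IsEngelVector ρ ξ (T v) := by
  intro x hx
  rw [← hT, hv x hx, map_smul]

end Weights

/-! ### Existence of Engel vectors -/

section Existence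

open EngelGroup

variable {p : ℕ} [Fact p.Prime] [Fact (2 < p)] {H : Type*} [NormedAddCommGroup H]
  [InnerProductSpace ℂ H]

theorem red_normal_eq (n : ℕ) (b c d : ℤ_[p]) :
    red n (normal ((p : ℤ_[p]) ^ n * b) ((p : ℤ_[p]) ^ n * c) ((p : ℤ_[p]) ^ n * d)) = red n 1 := by
  have h : ∀ a : ℤ_[p], (Ideal.Quotient.mk _ ((p : ℤ_[p]) ^ n * a) : ZpMod p n)
      = Ideal.Quotient.mk _ 0 := fun a => by
    rw [mk_eq_mk_iff, sub_zero]
    exact dvd_mul_right _ _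
  funext i
  fin_cases i
  · rfl
  · exact h b
  · exact h c
  · exact h d

theorem red_shift_eq (n : ℕ) (a : ℤ_[p]) : red n (shift ((p : ℤ_[p]) ^ n * a)) = red n 1 := by
  have h : (Ideal.Quotient.mk _ ((p : ℤ_[p]) ^ n * a) : ZpMod p n) = Ideal.Quotient.mk _ 0 := by
    rw [mk_eq_mk_iff, sub_zero]
    exact dvd_mul_right _ _
  funext i
  fin_cases i
  · exact h
  all_goals rfl

/-- The abelian normal subgroup `x₁ = 0` has a weight vector in every non-zero finite-dimensional
invariant subspace on which a congruence subgroup acts trivially. -/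
theorem exists_isWeight (ρ : UnitaryRep (EngelGroup p) H) (W : Submodule ℂ H)
    [FiniteDimensional ℂ W] (hW0 : W ≠ ⊥) (hW : ∀ g, ∀ a ∈ W, ρ g a ∈ W) {n : ℕ}
    (hn : ∀ x : EngelGroup p, red n x = red n 1 → ∀ a ∈ W, ρ x a = a) :
    ∃ (η₂ η₃ η₄ : ℚ_[p]) (v : H), v ∈ W ∧ v ≠ 0 ∧ IsWeight ρ η₂ η₃ η₄ v := by
  let A : ℤ_[p] → H →ₗ[ℂ] H := fun a => (ρ (normal a 0 0)).toLinearEquiv.toLinearMap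
  let B : ℤ_[p] → H →ₗ[ℂ] H := fun a => (ρ (normal 0 a 0)).toLinearEquiv.toLinearMap
  let C : ℤ_[p] → H →ₗ[ℂ] H := fun a => (ρ (normal 0 0 a)).toLinearEquiv.toLinearMap
  have hcomm : ∀ (b c d b' c' d' : ℤ_[p]) (v : H),
      ρ (normal b c d) (ρ (normal b' c' d') v) = ρ (normal b' c' d') (ρ (normal b c d) v) := by
    intro b c d b' c' d' v
    rw [← ρ.mul_apply, ← ρ.mul_apply, normal_mul_normal, normal_mul_normal, add_comm b, add_comm c,
      add_comm d]
  have hA : ∀ a b v, A (a + b) v = A a (A b v) := by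
    intro a b v
    change ρ _ v = ρ _ (ρ _ v)
    rw [← ρ.mul_apply, normal_mul_normal, add_zero]
  have hB : ∀ a b v, B (a + b) v = B a (B b v) := by
    intro a b v
    change ρ _ v = ρ _ (ρ _ v)
    rw [← ρ.mul_apply, normal_mul_normal, add_zero]
  have hC : ∀ a b v, C (a + b) v = C a (C b v) := by
    intro a b v
    change ρ _ v = ρ _ (ρ _ v)
    rw [← ρ.mul_apply, normal_mul_normal, add_zero]
  obtain ⟨η₂, h2⟩ := exists_charSpace_ne_bot A hA W hW0 (fun a => hW _) n fun a v hv =>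
    hn _ (by simpa using red_normal_eq n a 0 0) v hv
  obtain ⟨η₃, h3⟩ := exists_charSpace_ne_bot B hB (W ⊓ charSpace A η₂) h2
    (fun a v hv => ⟨hW _ v hv.1, map_mem_charSpace (B a) (fun _ _ => hcomm ..) hv.2⟩) n
    fun a v hv => hn _ (by simpa using red_normal_eq n 0 a 0) v hv.1
  obtain ⟨η₄, h4⟩ := exists_charSpace_ne_bot C hC (W ⊓ charSpace A η₂ ⊓ charSpace B η₃) h3
    (fun a v hv => ⟨⟨hW _ v hv.1.1, map_mem_charSpace (C a) (fun _ _ => hcomm ..) hv.1.2⟩,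
      map_mem_charSpace (C a) (fun _ _ => hcomm ..) hv.2⟩) n
    fun a v hv => hn _ (by simpa using red_normal_eq n 0 0 a) v hv.1.1
  obtain ⟨v, ⟨⟨⟨hvW, hvA⟩, hvB⟩, hvC⟩, hv0⟩ := (Submodule.ne_bot_iff _).1 h4
  refine ⟨η₂, η₃, η₄, v, hvW, hv0, fun b c d => ?_⟩
  have e : normal b c d = normal b 0 0 * (normal 0 c 0 * normal 0 0 d) := by
    rw [normal_mul_normal, normal_mul_normal]
    simp
  have eA : ρ (normal b 0 0) v = padicExp (η₂ * (b : ℚ_[p])) • v := mem_charSpace.1 hvA b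
  have eB : ρ (normal 0 c 0) v = padicExp (η₃ * (c : ℚ_[p])) • v := mem_charSpace.1 hvB c
  have eC : ρ (normal 0 0 d) v = padicExp (η₄ * (d : ℚ_[p])) • v := mem_charSpace.1 hvC d
  rw [e, ρ.mul_apply, ρ.mul_apply, eC, map_smul, eB, map_smul, map_smul, eA, smul_smul, smul_smul,
    padicExp_add, padicExp_add]
  congr 1
  ring

/-- An invariant subspace as in `exists_isWeight` contains an Engel vector for some `ξ` in the
dual. -/
theorem exists_isEngelVector_of_finiteDimensional (ρ : UnitaryRep (EngelGroup p) H)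
    (W : Submodule ℂ H) [FiniteDimensional ℂ W] (hW0 : W ≠ ⊥) (hW : ∀ g, ∀ a ∈ W, ρ g a ∈ W) {n : ℕ}
    (hn : ∀ x : EngelGroup p, red n x = red n 1 → ∀ a ∈ W, ρ x a = a) :
    ∃ ξ ∈ engelDual p, ∃ w ∈ W, w ≠ 0 ∧ IsEngelVector ρ ξ w := by
  obtain ⟨η₂, η₃, η₄, v, hvW, hv0, hv⟩ := exists_isWeight ρ W hW0 hW hn
  have hmk : ∀ η : ℚ_[p], η - ZpDual.rep (η : ZpDual p) ∈ padicIntSubgroup p := fun η => by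
    rw [← neg_sub]
    exact neg_mem (ZpDual.rep_mk_sub_mem η)
  -- move the weight within its orbit to the chosen representative
  obtain ⟨a, l₂, l₃, hl, h2, h3⟩ := exists_isOrbitRep η₂ (η₃ : ZpDual p) (η₄ : ZpDual p)
  have hv' := ((hv.congr (by rw [sub_self]; exact zero_mem _) (hmk η₃) (hmk η₄)).shift a).congr
    h2 h3 (by rw [sub_self]; exact zero_mem _)
  set l₄ : ZpDual p := (η₄ : ZpDual p) with hl₄
  set v' := ρ (shift a) v with hv'e
  have hv'0 : v' ≠ 0 := by
    rw [hv'e]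
    exact (map_ne_zero_iff _ (ρ (shift a)).injective).2 hv0
  -- the stabilizer of the weight acts on the weight space
  let m := engelLevel ![0, l₂, l₃, l₄]
  let V : Submodule ℂ H :=
    { carrier := {u | u ∈ W ∧ IsWeight ρ l₂.rep l₃.rep l₄.rep u}
      add_mem' := by
        rintro u u' ⟨hu, hu1⟩ ⟨hu', hu1'⟩
        refine ⟨add_mem hu hu', fun b c d => ?_⟩
        rw [map_add, hu1, hu1', smul_add]
      zero_mem' := ⟨zero_mem _, fun b c d => by rw [map_zero, smul_zero]⟩
      smul_mem' := by
        rintro c u ⟨hu, hu1⟩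
        refine ⟨W.smul_mem c hu, fun b c d => ?_⟩
        rw [map_smul, hu1, smul_comm] }
  have hVW : V ≤ W := fun u hu => hu.1
  have : FiniteDimensional ℂ V := Submodule.finiteDimensional_of_le hVW
  have hV0 : V ≠ ⊥ := (Submodule.ne_bot_iff _).2 ⟨v', ⟨hW _ v hvW, hv'⟩, hv'0⟩
  let A : ℤ_[p] → H →ₗ[ℂ] H := fun a =>
    (ρ (shift ((p : ℤ_[p]) ^ m * a))).toLinearEquiv.toLinearMap
  have hA : ∀ a b v, A (a + b) v = A a (A b v) := by
    intro a b v
    change ρ _ v = ρ _ (ρ _ v)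
    rw [← ρ.mul_apply, shift_mul_shift, mul_add]
  obtain ⟨η, hη⟩ := exists_charSpace_ne_bot A hA V hV0 (by
      intro a u hu
      refine ⟨hW _ u hu.1, ?_⟩
      obtain ⟨g3, g4⟩ := dvd_engelLevel ![0, l₂, l₃, l₄] (dvd_mul_right ((p : ℤ_[p]) ^ m) a)
      refine (hu.2.shift ((p : ℤ_[p]) ^ m * a)).congr ?_ ?_ (by rw [sub_self]; exact zero_mem _)
      · convert add_mem (neg_mem g3) (mul_coe_mem g4 (halfZp p * ((p : ℤ_[p]) ^ m * a))) using 1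
        rw [PadicInt.coe_mul (halfZp p), coe_halfZp]
        change _ = -(l₃.rep * _) + l₄.rep * _ * _
        ring
      · convert neg_mem g4 using 1
        change _ = -(l₄.rep * _)
        ring) n (by
      intro a u hu
      refine hn _ ?_ u hu.1
      rw [mul_left_comm]
      exact red_shift_eq n _)
  obtain ⟨w, ⟨⟨hwW, hw⟩, hwA⟩, hw0⟩ := (Submodule.ne_bot_iff _).1 hη
  obtain ⟨l₁, hl₁, hl₁η⟩ := exists_rep_mem_quotReps m (η / (p : ℚ_[p]) ^ m)
  refine ⟨![l₁, l₂, l₃, l₄], (mem_engelDual_iff _).2 ⟨hl₁, hl⟩, w, hwW, hw0,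
    isEngelVector_of_isWeight hw fun a => ?_⟩
  refine (mem_charSpace.1 hwA a).trans ?_
  congr 1
  apply padicExp_congr
  have hp : (p : ℚ_[p]) ^ m ≠ 0 := pow_ne_zero _ natCast_prime_ne_zero
  convert neg_mem (mul_coe_mem hl₁η a) using 1
  change η * a - l₁.rep * (((p : ℤ_[p]) ^ m * a : ℤ_[p]) : ℚ_[p]) = _
  push_cast
  field_simp
  ring

/-- Every non-zero closed invariant subspace contains an Engel vector. -/
theorem exists_isEngelVector [CompleteSpace H] (ρ : UnitaryRep (EngelGroup p) H)
    (W : Submodule ℂ H) (hWc : IsClosed (W : Set H)) (hW : ∀ g, ∀ a ∈ W, ρ g a ∈ W) (hW0 : W ≠ ⊥) :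
    ∃ ξ ∈ engelDual p, ∃ w ∈ W, w ≠ 0 ∧ IsEngelVector ρ ξ w := by
  obtain ⟨n, w, hwW, hw0, hw⟩ := exists_fixed_vector ρ W hWc hW hW0
  obtain ⟨hfd, htriv⟩ := orbitSpan_of_fixed ρ hw
  have hle : ρ.orbitSpan w ≤ W := by
    refine Submodule.span_le.2 ?_
    rintro _ ⟨g, rfl⟩
    exact hW g w hwW
  obtain ⟨ξ, hξ, v, hv, hv0, hvξ⟩ := exists_isEngelVector_of_finiteDimensional ρ (ρ.orbitSpan w)
    ((Submodule.ne_bot_iff _).2 ⟨w, ρ.mem_orbitSpan w, hw0⟩)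
    (fun g a ha => ρ.apply_mem_orbitSpan w g ha) htriv
  exact ⟨ξ, hξ, v, hle hv, hv0, hvξ⟩

theorem UnitaryRep.IsIrreducible.finiteDimensional [CompleteSpace H]
    {ρ : UnitaryRep (EngelGroup p) H} (hρ : ρ.IsIrreducible) : FiniteDimensional ℂ H := by
  have := hρ.1
  obtain ⟨n, w, -, hw0, hw⟩ := exists_fixed_vector ρ ⊤ isClosed_univ (fun _ _ _ => trivial)
    top_ne_bot
  obtain ⟨hfd, -⟩ := orbitSpan_of_fixed ρ hw
  have htop := hρ.orbitSpan_eq_top hw0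
  rw [htop] at hfd
  exact Module.Finite.equiv (Submodule.topEquiv (R := ℂ) (M := H))

end Existence

/-! ### Uniqueness of Engel vectors in `H_ξ` -/

section Uniqueness

open EngelGroup

variable {p : ℕ} [Fact p.Prime]

theorem engelVec_ne_zero (ξ : Fin 4 → ZpDual p) (h : ZpMod p (engelLevel ξ)) :
    engelVec ξ h ≠ 0 := (orthonormal_engelVec ξ).ne_zero h

variable [Fact (2 < p)]

theorem isEngelVector_engelVec (ξ : Fin 4 → ZpDual p) :
    IsEngelVector (engelRep ξ) ξ (engelVec ξ 0) := by
  classical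
  intro x hx
  apply (engelONB ξ).repr.injective
  ext h
  rw [repr_engelRep, map_smul, PiLp.smul_apply, mk_eq_zero_iff.2 hx, add_zero, ← engelONB_apply,
    OrthonormalBasis.repr_self, PiLp.single_apply, smul_eq_mul]
  split_ifs with hh
  · rw [hh, ← map_zero (Ideal.Quotient.mk _), engelMult_mk, engelPhase_eq]
    simp [engelQuad]
  · rw [mul_zero, mul_zero]

/-- The space `H_ξ` contains an Engel vector for no other element of the dual, and `φ_0` is its only
one up to scalars. -/
theorem eq_of_isEngelVector {ξ ξ' : Fin 4 → ZpDual p} (hξ : ξ ∈ engelDual p)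
    (hξ' : ξ' ∈ engelDual p) {φ : engelSpace ξ} (hφ0 : φ ≠ 0)
    (hφ : IsEngelVector (engelRep ξ) ξ' φ) :
    ξ = ξ' ∧ ∃ c : ℂ, c ≠ 0 ∧ φ = c • engelVec ξ 0 := by
  classical
  rw [mem_engelDual_iff] at hξ hξ'
  set f := (engelONB ξ).repr φ with hf
  -- the weight of `φ` is that of every basis vector on which `φ` has a non-zero coordinate
  have key : ∀ b : ℤ_[p], f (Ideal.Quotient.mk _ b) ≠ 0 →
      ξ 1 = ξ' 1 ∧ ξ 2 = ξ' 2 ∧ ξ 3 = ξ' 3 ∧ (ξ 2).rep * b ∈ padicIntSubgroup p ∧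
        (ξ 3).rep * b ∈ padicIntSubgroup p := by
    intro b hb
    have hph : ∀ y₂ y₃ y₄ : ℤ_[p], engelPhase ξ (normal y₂ y₃ y₄) b
        - ((ξ' 1).rep * y₂ + (ξ' 2).rep * y₃ + (ξ' 3).rep * y₄) ∈ padicIntSubgroup p := by
      intro y₂ y₃ y₄
      rw [← padicExp_eq_iff]
      have h1 := repr_engelRep ξ (normal y₂ y₃ y₄) φ (Ideal.Quotient.mk _ b)
      have h0 : normal y₂ y₃ y₄ 0 = 0 := rfl
      rw [hφ.isWeight y₂ y₃ y₄, map_smul, PiLp.smul_apply, smul_eq_mul, engelMult_mk, h0, map_zero,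
        add_zero] at h1
      exact (mul_right_cancel₀ hb h1).symm
    have hval : ∀ y₂ y₃ y₄ : ℤ_[p], engelPhase ξ (normal y₂ y₃ y₄) b
        = (ξ 1).rep * y₂ + (ξ 2).rep * (y₃ + b * y₂)
          + (ξ 3).rep * (y₄ + b * y₃ + b ^ 2 / 2 * y₂) := by
      intro y₂ y₃ y₄
      change (ξ 0).rep * ((0 : ℤ_[p]) : ℚ_[p]) + (ξ 1).rep * y₂ + (ξ 2).rep * (y₃ + b * y₂)
          + (ξ 3).rep * (y₄ + b * y₃ + b ^ 2 / 2 * y₂) = _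
      rw [PadicInt.coe_zero, mul_zero, zero_add]
    simp only [hval] at hph
    refine hξ.2.unique hξ'.2 ?_ ?_ ?_
    · convert hph 0 0 1 using 1
      push_cast
      ring
    · convert hph 0 1 0 using 1
      push_cast
      ring
    · convert hph 1 0 0 using 1
      push_cast
      ring
  have hzero : ∀ h : ZpMod p (engelLevel ξ), h ≠ 0 → f h = 0 := by
    intro h hh
    by_contra hfh
    obtain ⟨b, rfl⟩ := Ideal.Quotient.mk_surjective h
    obtain ⟨-, -, -, hb2, hb3⟩ := key b hfh
    exact hh (mk_eq_zero_iff.2 (engelLevel_dvd ξ hb2 hb3))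
  have hf0 : f 0 ≠ 0 := by
    intro h0
    apply hφ0
    apply (engelONB ξ).repr.injective
    rw [map_zero]
    ext h
    by_cases hh : h = 0
    · rw [hh]
      exact h0
    · exact hzero h hh
  obtain ⟨h1, h2, h3, -, -⟩ := key 0 (by rwa [map_zero])
  have hlev : engelLevel ξ' = engelLevel ξ := by rw [engelLevel, engelLevel, h2, h3]
  have h0 : ξ 0 = ξ' 0 := by
    rw [hlev] at hξ'
    apply eq_of_rep_mem_quotReps hξ.1 hξ'.1
    have hdvd : (p : ℤ_[p]) ^ engelLevel ξ ∣ shift ((p : ℤ_[p]) ^ engelLevel ξ) 0 := dvd_rfl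
    have e1 := repr_engelRep ξ (shift ((p : ℤ_[p]) ^ engelLevel ξ)) φ (Ideal.Quotient.mk _ 0)
    rw [hφ _ (by rw [hlev]; exact hdvd), map_smul, PiLp.smul_apply, smul_eq_mul, engelMult_mk,
      mk_eq_zero_iff.2 hdvd, add_zero, engelPhase_eq, map_zero] at e1
    have e2 := (mul_right_cancel₀ hf0 e1).symm
    have e3 : engelQuad ξ (shift ((p : ℤ_[p]) ^ engelLevel ξ)) 0 = 0 := by simp [engelQuad]
    rw [e3, add_zero, engelDot_shift, engelDot_shift, padicExp_eq_iff, ← sub_mul] at e2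
    simpa using e2
  refine ⟨?_, f 0, hf0, ?_⟩
  · funext i
    fin_cases i
    · exact h0
    · exact h1
    · exact h2
    · exact h3
  · apply (engelONB ξ).repr.injective
    ext h
    rw [map_smul, PiLp.smul_apply, ← engelONB_apply, OrthonormalBasis.repr_self, PiLp.single_apply,
      smul_eq_mul]
    split_ifs with hh
    · rw [hh, mul_one]
    · rw [mul_zero]
      exact hzero h hh

/-- The translates of `φ_0` are the basis vectors, up to scalars. -/
theorem engelVec_mem_of_zero_mem (ξ : Fin 4 → ZpDual p) {W : Submodule ℂ (engelSpace ξ)}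
    (hW : ∀ g, ∀ a ∈ W, engelRep ξ g a ∈ W) (h0 : engelVec ξ 0 ∈ W) (h : ZpMod p (engelLevel ξ)) :
    engelVec ξ h ∈ W := by
  classical
  obtain ⟨b, rfl⟩ := Ideal.Quotient.mk_surjective h
  have h1 := hW (shift (-b)) _ h0
  have h2 : engelRep ξ (shift (-b)) (engelVec ξ 0)
      = engelMult ξ (shift (-b)) (Ideal.Quotient.mk _ b) •
        engelVec ξ (Ideal.Quotient.mk _ b) := by
    apply (engelONB ξ).repr.injective
    ext k
    have hb : shift (-b) 0 = -b := rfl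
    rw [repr_engelRep, map_smul, PiLp.smul_apply, ← engelONB_apply, ← engelONB_apply,
      OrthonormalBasis.repr_self, OrthonormalBasis.repr_self, PiLp.single_apply, PiLp.single_apply,
      hb, map_neg, smul_eq_mul]
    by_cases hk : k = Ideal.Quotient.mk _ b
    · rw [hk, add_neg_cancel, if_pos rfl, if_pos rfl]
    · rw [if_neg (fun h => hk (eq_of_sub_eq_zero (by rw [sub_eq_add_neg, h]))), if_neg hk, mul_zero,
        mul_zero]
  rw [h2] at h1
  refine (W.smul_mem_iff ?_).1 h1
  exact norm_ne_zero_iff.1 (by rw [norm_engelMult]; exact one_ne_zero)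

theorem isIrreducible_engelRep {ξ : Fin 4 → ZpDual p} (hξ : ξ ∈ engelDual p) :
    (engelRep ξ).IsIrreducible := by
  refine ⟨⟨engelVec ξ 0, 0, engelVec_ne_zero ξ 0⟩, fun W hWc hW => ?_⟩
  by_cases hW0 : W = ⊥
  · exact Or.inl hW0
  right
  obtain ⟨ξ', hξ', φ, hφW, hφ0, hφ⟩ := exists_isEngelVector (engelRep ξ) W hWc hW hW0
  obtain ⟨-, c, hc, rfl⟩ := eq_of_isEngelVector hξ hξ' hφ0 hφ
  have h0 := (W.smul_mem_iff hc).1 hφW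
  rw [eq_top_iff]
  refine (span_engelVec ξ).trans (Submodule.span_le.2 ?_)
  rintro _ ⟨h, rfl⟩
  exact engelVec_mem_of_zero_mem ξ hW h0 h

theorem eq_of_equivalent_engelRep {ξ ξ' : Fin 4 → ZpDual p} (hξ : ξ ∈ engelDual p)
    (hξ' : ξ' ∈ engelDual p) (h : (engelRep ξ').Equivalent (engelRep ξ)) : ξ = ξ' := by
  obtain ⟨T, hT⟩ := h
  exact (eq_of_isEngelVector hξ hξ'
    ((map_ne_zero_iff _ T.injective).2 (engelVec_ne_zero ξ' 0))
    ((isEngelVector_engelVec ξ').map hT)).1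

/-- Every irreducible unitary representation is equivalent to some `π_ξ`. -/
theorem exists_equivalent_engelRep {H : Type*} [NormedAddCommGroup H] [InnerProductSpace ℂ H]
    [CompleteSpace H] {ρ : UnitaryRep (EngelGroup p) H} (hρ : ρ.IsIrreducible) :
    ∃ ξ ∈ engelDual p, ρ.Equivalent (engelRep ξ) := by
  have := hρ.1
  have := hρ.finiteDimensional
  obtain ⟨ξ, hξ, w, -, hw0, hw⟩ := exists_isEngelVector ρ ⊤ isClosed_univ (fun _ _ _ => trivial)
    top_ne_bot
  exact ⟨ξ, hξ, hρ.equivalent_of_isEngelVector (isIrreducible_engelRep hξ) hw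
    (isEngelVector_engelVec ξ) hw0 (engelVec_ne_zero ξ 0)⟩

end Uniqueness

/-! ### The unitary dual of the Engel group -/

theorem theorem1p3 (p : ℕ) [Fact p.Prime] [Fact (2 < p)] :
    ∃ (π : ∀ ξ : engelDual p, UnitaryRep (EngelGroup p) (engelSpace ξ.1))
      (hirr : ∀ ξ : engelDual p, (π ξ).IsIrreducible),
      -- the action on the space `H_ξ`
      (∀ (ξ : engelDual p) (x : EngelGroup p) (φ : engelSpace ξ.1),
        ((π ξ x φ : engelSpace ξ.1) : L2Zp p) =ᵐ[haarZp p]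
          fun u => padicExp (engelPhase ξ.1 x u) * (φ : L2Zp p) (u + x 0)) ∧
      -- the identification of the unitary dual with the index set
      Function.Bijective
        (fun ξ : engelDual p =>
          (UnitaryDual.mk (π ξ) (hirr ξ) : UnitaryDual.{0, 0} (EngelGroup p))) ∧
      -- every irreducible unitary representation, on a Hilbert space in any universe, is
      -- equivalent to exactly one `π_ξ`
      (∀ (H : Type*) [NormedAddCommGroup H] [InnerProductSpace ℂ H] [CompleteSpace H]
        (ρ : UnitaryRep (EngelGroup p) H), ρ.IsIrreducible →
          ∃! ξ : engelDual p, ρ.Equivalent (π ξ)) ∧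
      -- the dimension of `H_ξ`
      (∀ ξ : engelDual p, (Module.finrank ℂ (engelSpace ξ.1) : ℝ)
        = max ‖(ξ.1 2).rep‖ ‖(ξ.1 3).rep‖) ∧
      -- the functions `φ_h` (which span `H_ξ` by definition) are an orthonormal basis of `H_ξ`
      (∀ ξ : engelDual p, Orthonormal ℂ (engelVec ξ.1)) ∧
      -- the matrix coefficients `(π_ξ(x) φ_h, φ_h')`, for arbitrary representatives `h, h'`
      (∀ (ξ : engelDual p) (x : EngelGroup p) (h h' : ℤ_[p]),
        inner ℂ (engelVec ξ.1 (Ideal.Quotient.mk _ h')) (π ξ x (engelVec ξ.1 (Ideal.Quotient.mk _ h)))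
          = padicExp (engelDot ξ.1 x + engelQuad ξ.1 x h') *
            (cosetZp (Ideal.Quotient.mk _ (h - h') : ZpMod p (engelLevel ξ.1))).indicator 1 (x 0)) ∧
      -- the characters
      (∀ (ξ : engelDual p) (x : EngelGroup p),
        (π ξ).character x
          = (engelNorm ξ.1 : ℂ) * padicExp (engelDot ξ.1 x) *
            (cosetZp (0 : ZpMod p (engelLevel ξ.1))).indicator 1 (x 0) *
            ∫ u : ℤ_[p], padicExp (engelQuad ξ.1 x u) ∂(haarZp p)) := by
  refine ⟨fun ξ => engelRep ξ.1, fun ξ => isIrreducible_engelRep ξ.2,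
    fun ξ x φ => coeFn_engelRep ξ.1 x φ, ⟨?_, ?_⟩, ?_, fun ξ => finrank_engelSpace ξ.1,
    fun ξ => orthonormal_engelVec ξ.1, fun ξ x h h' => inner_engelRep ξ.1 x h h',
    fun ξ x => character_engelRep ξ.1 x⟩
  · intro ξ ξ' h
    exact (Subtype.ext (eq_of_equivalent_engelRep ξ'.2 ξ.2 (Quotient.exact h))).symm
  · intro c
    induction c using Quotient.inductionOn with
    | h σ =>
      obtain ⟨ξ, hξ, h⟩ := exists_equivalent_engelRep σ.irreducible
      exact ⟨⟨ξ, hξ⟩, Quotient.sound h.symm⟩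
  · intro H _ _ _ ρ hρ
    obtain ⟨ξ, hξ, h⟩ := exists_equivalent_engelRep hρ
    refine ⟨⟨ξ, hξ⟩, h, fun ξ' h' => ?_⟩
    have h' : ρ.Equivalent (engelRep ξ'.1) := h'
    have heq : ξ = ξ'.1 := eq_of_equivalent_engelRep hξ ξ'.2 (h'.symm.trans h)
    exact Subtype.ext heq.symm

end
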